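/- Setting. Let $(\boldsymbol x_i,y_i)$, $i=1,2,\dots$, be i.i.d. with $\boldsymbol x_i\in\mathbb R^d$, $y_i\in\mathbb R$ and $E(y_i\mid \boldsymbol x_i)=\psi(\boldsymbol\beta_t^T\boldsymbol x_i)$, where $\psi:\mathbb R\to\mathbb R$ is twice continuously differentiable with $\dot\psi>0$ everywhere. Let $\mathcal F_N=\sigma(\boldsymbol x_i,y_i:i\le N)$. The full-data quasi-likelihood estimator $\hat{\boldsymbol\beta}_{\rm QLE}$ is an $\mathcal F_N$-measurable solution of $Q(\boldsymbol\beta)=\sum_{i=1}^N\{y_i-\psi(\boldsymbol\beta^T\boldsymbol x_i)\}\boldsymbol x_i=\boldsymbol 0$. In Poisson subsampling, $p_i\in(0,1]$ $(i\le N)$ are $\mathcal F_N$-measurable (they may depend on the whole sample and on the subsampling scheme), and, given $\mathcal F_N$, the indicators $\delta_1,\dots,\delta_N$ are independent with $\delta_i\sim\mathrm{Bernoulli}(p_i)$; $r=\sum_{i=1}^N p_i$ is the expected subsample size. The subsample estimator $\tilde{\boldsymbol\beta}$ is any random vector that solves $$Q^*(\boldsymbol\beta)=\sum_{i=1}^N\frac{\delta_i}{p_i}\{y_i-\psi(\boldsymbol\beta^T\boldsymbol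 x_i)\}\boldsymbol x_i=\boldsymbol 0$$ whenever this equation has a solution in the parameter space $\Lambda$ below. All limits are taken as $N\to\infty$ and $r\to\infty$ (in probability, if $r$ is random), along an arbitrary family of subsampling schemes. Assumptions. 1. $\Lambda=\{\boldsymbol\beta\in\mathbb R^d:\|\boldsymbol\beta\|_1\le B\}$ for a constant $B$; $\boldsymbol\beta_t$ is an inner point of $\Lambda$ and, with probability tending to one as $N\to\infty$, $\hat{\boldsymbol\beta}_{\rm QLE}$ is an inner point of $\Lambda$ with $Q(\hat{\boldsymbol\beta}_{\rm QLE})=\boldsymbol 0$. 2. $E\|\boldsymbol x_1\|^9$, $E|y_1|^6$, $E\{\sup_{\boldsymbol\beta\in\Lambda}\psi^6(\boldsymbol\beta^T\boldsymbol x_1)\}$ and $E\{\sup_{\boldsymbol\beta\in\Lambda}\dot\psi^6(\boldsymbol\beta^T\boldsymbol x_1)\}$ are finite. 3. With $\Sigma_\psi(\boldsymbol\beta)=N^{-1}\sum_{i=1}^N\dot\psi(\boldsymbol\beta^T\boldsymbol x_i)\boldsymbol x_i\boldsymbol x_i^T$, there is a constant $c>0$ such that $\inf_{\boldsymbol\beta\in\Lambda}\lambda_{\min}\{\Sigma_\psi(\boldsymbol\beta)\}\ge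 c$ with probability tending to one as $N\to\infty$. 4. There are measurable functions $m_1,m_2$ with $E\{m_1^3(\boldsymbol x_i)\}<\infty$ and $E\{m_2(\boldsymbol x_i)\}<\infty$ such that almost surely, for all $\boldsymbol\beta_1,\boldsymbol\beta_2\in\Lambda$, $|\psi(\boldsymbol\beta_1^T\boldsymbol x_i)-\psi(\boldsymbol\beta_2^T\boldsymbol x_i)|\le m_1(\boldsymbol x_i)\|\boldsymbol\beta_1-\boldsymbol\beta_2\|$ and $\|\{\dot\psi(\boldsymbol\beta_1^T\boldsymbol x_i)-\dot\psi(\boldsymbol\beta_2^T\boldsymbol x_i)\}\boldsymbol x_i\boldsymbol x_i^T\|_s\le m_2(\boldsymbol x_i)\|\boldsymbol\beta_1-\boldsymbol\beta_2\|$, where $\|\cdot\|_s$ is the spectral norm. 5. $\max_{i\le N}(Np_i)^{-1}=O_P(r^{-1})$, i.e. for every $\eta>0$ there is a constant $C$ such that eventually $P\{\max_{i\le N}(Np_i)^{-1}>C r^{-1}\}\le\eta$. Theorem. Under Assumptions 1–5, as $N\to\infty$ and $r\to\infty$: (a) $\tilde{\boldsymbol\beta}$ is consistent for $\hat{\boldsymbol\beta}_{\rm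 QLE}$ in conditional probability given $\mathcal F_N$, in probability: for every $\rho>0$, $P(\|\tilde{\boldsymbol\beta}-\hat{\boldsymbol\beta}_{\rm QLE}\|\ge\rho\mid\mathcal F_N)\to0$ in probability. (b) The rate of convergence is $r^{-1/2}$: for every $\epsilon>0$ and $\eta>0$ there is a finite constant $\Delta>0$ such that, eventually (for all large $N$ and $r$), with probability at least $1-\eta$, $$P(\|\tilde{\boldsymbol\beta}-\hat{\boldsymbol\beta}_{\rm QLE}\|\ge r^{-1/2}\Delta\mid\mathcal F_N)<\epsilon .$$ (c) If, moreover, the bound in Assumption 5 holds with one constant, that is, for some $C$, $\max_{i\le N}(Np_i)^{-1}\le C r^{-1}$ with probability tending to one, then $\Delta=\Delta_\epsilon$ can be chosen depending on $\epsilon$ only: for every $\epsilon>0$ there is a finite $\Delta_\epsilon>0$ such that $P(\|\tilde{\boldsymbol\beta}-\hat{\boldsymbol\beta}_{\rm QLE}\|\ge r^{-1/2}\Delta_\epsilon\mid\mathcal F_N)<\epsilon$ with probability tending to one. -/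

import Mathlib

open MeasureTheory ProbabilityTheory Filter Topology
open scoped ENNReal

noncomputable section

namespace PoissonQLE

/-- Covariates and regression parameters live in `ℝ^d` with the Euclidean norm. -/
abbrev Vec (d : ℕ) : Type := EuclideanSpace ℝ (Fin d)

/-- The parameter space: the closed `l₁` ball of radius `B`. -/
def paramBall (d : ℕ) (B : ℝ) : Set (Vec d) := {β | ∑ j, |β j| ≤ B}

/-- The quasi-score `Q(β) = ∑_{i < N} (y_i - ψ(βᵀ x_i)) x_i` of the first `N` observations. -/
def quasiScore {d : ℕ} (ψ : ℝ → ℝ) (xs : ℕ → Vec d) (ys : ℕ → ℝ) (N : ℕ) (β : Vec d) : Vec d :=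
  ∑ i ∈ Finset.range N, (ys i - ψ (inner ℝ β (xs i))) • xs i

/-- The subsample weighted quasi-score
`Q*(β) = ∑_{i < N, δ_i = 1} p_i⁻¹ (y_i - ψ(βᵀ x_i)) x_i`. -/
def weightedScore {d : ℕ} (ψ : ℝ → ℝ) (xs : ℕ → Vec d) (ys : ℕ → ℝ) (N : ℕ)
    (ps : ℕ → ℝ) (ds : ℕ → Bool) (β : Vec d) : Vec d :=
  ∑ i ∈ (Finset.range N).filter (fun i => ds i = true),
    ((ps i)⁻¹ * (ys i - ψ (inner ℝ β (xs i)))) • xs i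

/-- The matrix `ψ'(βᵀ v) v vᵀ`. -/
def infoTerm {d : ℕ} (ψ : ℝ → ℝ) (β v : Vec d) : Matrix (Fin d) (Fin d) ℝ :=
  deriv ψ (inner ℝ β v) • Matrix.vecMulVec v.ofLp v.ofLp

/-- The matrix `Σ_ψ(β) = N⁻¹ ∑_{i < N} ψ'(βᵀ x_i) x_i x_iᵀ`. -/
def infoMatrix {d : ℕ} (ψ : ℝ → ℝ) (xs : ℕ → Vec d) (N : ℕ) (β : Vec d) :
    Matrix (Fin d) (Fin d) ℝ :=
  (N : ℝ)⁻¹ • ∑ i ∈ Finset.range N, infoTerm ψ β (xs i)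

/-- The spectral norm of a real square matrix: the operator norm on Euclidean space. -/
def spectralNorm {d : ℕ} (A : Matrix (Fin d) (Fin d) ℝ) : ℝ :=
  ‖Matrix.toEuclideanCLM (n := Fin d) (𝕜 := ℝ) A‖

variable {Ω : Type*} [mΩ : MeasurableSpace Ω]

/-- The `σ`-algebra generated by the full data `(x_i, y_i)`, `i < N`. -/
@[reducible] def dataSigma {d : ℕ} (x : ℕ → Ω → Vec d) (y : ℕ → Ω → ℝ) (N : ℕ) : MeasurableSpace Ω :=
  MeasurableSpace.comap (fun ω (i : Fin N) => (x i ω, y i ω)) inferInstance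

/-- The conditional probability `P(A | F_N)` given the full data. -/
def condProbData {d : ℕ} (μ : Measure Ω) (x : ℕ → Ω → Vec d) (y : ℕ → Ω → ℝ) (N : ℕ)
    (A : Set Ω) : Ω → ℝ :=
  μ⟦A | dataSigma x y N⟧

/-- The events `E k` hold with probability approaching one along `l`
(stated through the complements, so that nothing depends on measurability of `E k`). -/
def WithProbToOne {ι : Type*} (μ : Measure Ω) (l : Filter ι) (E : ι → Set Ω) : Prop :=
  Tendsto (fun k => μ (E k)ᶜ) l (𝓝 0)

/-- `X k = O_P(a k)` along `l`. -/
def IsBigOP {ι : Type*} (μ : Measure Ω) (l : Filter ι) (X a : ι → Ω → ℝ) : Prop :=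
  ∀ η : ℝ, 0 < η → ∃ C : ℝ, ∀ᶠ k in l, μ.real {ω | C * |a k ω| < |X k ω|} ≤ η

/-- The model: the pairs `(x_i, y_i)` are i.i.d., `E(y_i | x_i) = ψ(β_tᵀ x_i)`, and `ψ` is `C²`
with `ψ' > 0`. -/
structure Model {d : ℕ} (μ : Measure Ω) (ψ : ℝ → ℝ) (βt : Vec d)
    (x : ℕ → Ω → Vec d) (y : ℕ → Ω → ℝ) : Prop where
  smooth : ContDiff ℝ 2 ψ
  deriv_pos : ∀ t, 0 < deriv ψ t
  measurable_x : ∀ i, Measurable (x i)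
  measurable_y : ∀ i, Measurable (y i)
  indep : iIndepFun (fun i ω => (x i ω, y i ω)) μ
  ident : ∀ i, IdentDistrib (fun ω => (x i ω, y i ω)) (fun ω => (x 0 ω, y 0 ω)) μ μ
  mean : ∀ i, μ[y i | MeasurableSpace.comap (x i) inferInstance]
    =ᵐ[μ] fun ω => ψ (inner ℝ βt (x i ω))

/-- The true parameter is an inner point of the parameter space; with probability approaching
one, the full-data estimator `βhat N` is an inner point and solves `Q(β) = 0`. As a statistic,
`βhat N` is a measurable function of the first `N` observations. -/
structure InnerPoints {d : ℕ} (μ : Measure Ω) (ψ : ℝ → ℝ) (B : ℝ) (βt : Vec d)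
    (x : ℕ → Ω → Vec d) (y : ℕ → Ω → ℝ) (βhat : ℕ → Ω → Vec d) : Prop where
  truth_mem : βt ∈ interior (paramBall d B)
  measurable_qle : ∀ N, Measurable[dataSigma x y N] (βhat N)
  qle : WithProbToOne μ atTop (fun N => {ω | βhat N ω ∈ interior (paramBall d B) ∧
    quasiScore ψ (fun i => x i ω) (fun i => y i ω) N (βhat N ω) = 0})

/-- Moment conditions. -/
structure MomentBounds {d : ℕ} (μ : Measure Ω) (ψ : ℝ → ℝ) (B : ℝ)
    (x : ℕ → Ω → Vec d) (y : ℕ → Ω → ℝ) : Prop where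
  x_moment : ∫⁻ ω, ‖x 0 ω‖ₑ ^ 9 ∂μ < ∞
  y_moment : ∫⁻ ω, ‖y 0 ω‖ₑ ^ 6 ∂μ < ∞
  mean_moment : ∫⁻ ω, ⨆ β ∈ paramBall d B, ‖ψ (inner ℝ β (x 0 ω))‖ₑ ^ 6 ∂μ < ∞
  deriv_moment : ∫⁻ ω, ⨆ β ∈ paramBall d B, ‖deriv ψ (inner ℝ β (x 0 ω))‖ₑ ^ 6 ∂μ < ∞

/-- For some `c > 0`, with probability approaching one, every eigenvalue of every `Σ_ψ(β)`,
`β` in the parameter space, is at least `c`. -/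
def UniformlyPosDef {d : ℕ} (μ : Measure Ω) (ψ : ℝ → ℝ) (B : ℝ) (x : ℕ → Ω → Vec d) : Prop :=
  ∃ c : ℝ, 0 < c ∧ WithProbToOne μ atTop (fun N => {ω | ∀ β ∈ paramBall d B,
    ∀ lam ∈ spectrum ℝ (infoMatrix ψ (fun i => x i ω) N β), c ≤ lam})

/-- Lipschitz conditions in `β`, with random constants `m₁(x_i)` and `m₂(x_i)`. -/
def LipschitzConditions {d : ℕ} (μ : Measure Ω) (ψ : ℝ → ℝ) (B : ℝ) (x : ℕ → Ω → Vec d) : Prop :=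
  ∃ m₁ m₂ : Vec d → ℝ, Measurable m₁ ∧ Measurable m₂ ∧
    (∀ i, ∀ᵐ ω ∂μ, ∀ β₁ ∈ paramBall d B, ∀ β₂ ∈ paramBall d B,
      |ψ (inner ℝ β₁ (x i ω)) - ψ (inner ℝ β₂ (x i ω))| ≤ m₁ (x i ω) * ‖β₁ - β₂‖ ∧
      spectralNorm (infoTerm ψ β₁ (x i ω) - infoTerm ψ β₂ (x i ω)) ≤ m₂ (x i ω) * ‖β₁ - β₂‖) ∧
    (∀ i, Integrable (fun ω => m₁ (x i ω) ^ 3) μ) ∧ (∀ i, Integrable (fun ω => m₂ (x i ω)) μ)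

/-- Poisson subsampling from the first `N` observations: the inclusion probabilities
`p_i ∈ (0, 1]` are functions of the data and, given the data, the inclusion indicators `δ_i`
are independent with `δ_i ∼ Bernoulli(p_i)`. -/
structure IsPoissonSubsample {d : ℕ} (μ : Measure Ω) (x : ℕ → Ω → Vec d) (y : ℕ → Ω → ℝ)
    (N : ℕ) (p : ℕ → Ω → ℝ) (δ : ℕ → Ω → Bool) : Prop where
  measurable_prob : ∀ i < N, Measurable[dataSigma x y N] (p i)
  prob_mem : ∀ i < N, ∀ ω, 0 < p i ω ∧ p i ω ≤ 1
  measurable_incl : ∀ i < N, Measurable (δ i)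
  cond_law : ∀ s ⊆ Finset.range N,
    condProbData μ x y N {ω | ∀ i ∈ Finset.range N, (δ i ω = true ↔ i ∈ s)}
      =ᵐ[μ] fun ω => ∏ i ∈ Finset.range N, (if i ∈ s then p i ω else 1 - p i ω)

/-- The expected subsample size `r = ∑_{i < N} p_i`. -/
def expectedSize (N : ℕ) (p : ℕ → Ω → ℝ) (ω : Ω) : ℝ := ∑ i ∈ Finset.range N, p i ω

/-- The largest weight `max_{i < N} (N p_i)⁻¹`. -/
def maxWeight (N : ℕ) (p : ℕ → Ω → ℝ) (ω : Ω) : ℝ := ⨆ i : Fin N, ((N : ℝ) * p i ω)⁻¹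

/-- `βtil` is a subsample estimator: a random vector which solves `Q*(β) = 0` whenever this
equation has a solution in the parameter space. -/
structure IsSubsampleEstimator {d : ℕ} (μ : Measure Ω) (ψ : ℝ → ℝ) (B : ℝ)
    (x : ℕ → Ω → Vec d) (y : ℕ → Ω → ℝ) (N : ℕ) (p : ℕ → Ω → ℝ) (δ : ℕ → Ω → Bool)
    (βtil : Ω → Vec d) : Prop where
  measurable : Measurable βtil
  solves : ∀ᵐ ω ∂μ,
    (∃ β ∈ paramBall d B, weightedScore ψ (fun i => x i ω) (fun i => y i ω) N
      (fun i => p i ω) (fun i => δ i ω) β = 0) →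
    weightedScore ψ (fun i => x i ω) (fun i => y i ω) N
      (fun i => p i ω) (fun i => δ i ω) (βtil ω) = 0

end PoissonQLE

end

open PoissonQLE

/-! The subsample score is a weighted sum with inverse probability weights, so given the data it is
unbiased for the full-data score, which vanishes at the full-data estimator. At that point it is
therefore pure sampling noise: its conditional variance is at most a sum of squared terms over
`p_i`, hence of order `N ^ 2 / r` when the weights are of order `r⁻¹`. The full-data information is
at least `c * N` in every direction, so on a sphere of radius `Δ * r ^ (-1/2)` around the full-data
estimator the curvature beats the noise once `Δ` is large, and the subsample score points inward
there.

An inward field on the sphere does two things. The score is minus the gradient of a potential, whose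
minimum over the ball must be interior, so a zero exists (`exists_totalScore_eq_zero`). Since `ψ` is
increasing, the score is monotone along rays, so there is no zero outside the sphere, however far
away (`norm_sub_lt_of_totalScore_eq_zero`). Existence inside the parameter space forces the
estimator to solve the equation; exclusion then localizes it, although it was never required to lie
in the parameter space.

The deterministic statement is `exists_zero_and_norm_sub_lt`. Its three inputs hold with high
conditional probability: small noise in the score and in the information matrix by Chebyshev
(`condProbData_chebyshev`), and a bounded weighted mean of the Lipschitz constants `m₂` by Markov
(`condProbData_markov_total`), as only a first moment is available. Curvature is compared at the
fixed point `βt`, and the score is dominated by functions evaluated at `βt`, so the law of large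
numbers applies to fixed functions; consistency of the full-data estimator
(`InnerPoints.consistent`) makes this legitimate. `exists_rate` puts these together, and all three
claims follow from it. -/

namespace PoissonQLE

/-! ### Moments of inverse probability weighted totals under Poisson sampling -/

section


/-- The probability of the inclusion pattern `s` among the units `A` under Poisson sampling. -/
noncomputable def patternProb (p : ℕ → ℝ) (A s : Finset ℕ) : ℝ :=
  ∏ i ∈ A, if i ∈ s then p i else 1 - p i

/-- The inverse probability weight of unit `i` when the units in `s` are sampled. -/
noncomputable def inclWeight (p : ℕ → ℝ) (s : Finset ℕ) (i : ℕ) : ℝ :=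
  if i ∈ s then (p i)⁻¹ else 0

lemma patternProb_nonneg {p : ℕ → ℝ} {A : Finset ℕ} (hp : ∀ i ∈ A, 0 < p i ∧ p i ≤ 1)
    (s : Finset ℕ) : 0 ≤ patternProb p A s := by
  refine Finset.prod_nonneg fun i hi => ?_
  have := hp i hi
  split_ifs <;> linarith

lemma inclWeight_nonneg {p : ℕ → ℝ} {A : Finset ℕ} (hp : ∀ i ∈ A, 0 < p i ∧ p i ≤ 1)
    (s : Finset ℕ) {i : ℕ} (hi : i ∈ A) : 0 ≤ inclWeight p s i := by
  unfold inclWeight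
  split_ifs
  · exact inv_nonneg.2 (hp i hi).1.le
  · exact le_rfl

/-- Conditioning on whether unit `a` is drawn: independence makes the pattern probability factor.
This is the induction step of every moment computation below. -/
lemma sum_patternProb_insert (p : ℕ → ℝ) {A : Finset ℕ} {a : ℕ} (ha : a ∉ A)
    (f : Finset ℕ → ℝ) :
    ∑ s ∈ (insert a A).powerset, patternProb p (insert a A) s * f s =
      ∑ s ∈ A.powerset, patternProb p A s * ((1 - p a) * f s + p a * f (insert a s)) := by
  rw [Finset.sum_powerset_insert ha, ← Finset.sum_add_distrib]
  refine Finset.sum_congr rfl fun s hs => ?_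
  have hs' := Finset.mem_powerset.1 hs
  have has : a ∉ s := fun h => ha (hs' h)
  have h1 : patternProb p (insert a A) s = (1 - p a) * patternProb p A s := by
    simp [patternProb, Finset.prod_insert ha, has]
  have h2 : patternProb p (insert a A) (insert a s) = p a * patternProb p A s := by
    simp only [patternProb, Finset.prod_insert ha, Finset.mem_insert_self, if_true]
    congr 1
    refine Finset.prod_congr rfl fun i hi => ?_
    have : i ≠ a := fun h => ha (h ▸ hi)
    simp [this]
  rw [h1, h2]
  ring

lemma inclWeight_insert_of_ne (p : ℕ → ℝ) (s : Finset ℕ) {a i : ℕ} (h : i ≠ a) :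
    inclWeight p (insert a s) i = inclWeight p s i := by
  simp [inclWeight, h]

lemma sum_patternProb (p : ℕ → ℝ) (A : Finset ℕ) :
    ∑ s ∈ A.powerset, patternProb p A s = 1 := by
  induction A using Finset.induction_on with
  | empty => simp [patternProb]
  | insert a A ha ih =>
    have := sum_patternProb_insert p ha (fun _ => 1)
    simpa [ih] using this

/-- The weighted sample total is conditionally unbiased. -/
lemma sum_patternProb_mul_total {p : ℕ → ℝ} {A : Finset ℕ} (hp : ∀ i ∈ A, 0 < p i ∧ p i ≤ 1)
    (b : ℕ → ℝ) :
    ∑ s ∈ A.powerset, patternProb p A s * ∑ i ∈ A, inclWeight p s i * b i = ∑ i ∈ A, b i := by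
  induction A using Finset.induction_on with
  | empty => simp
  | insert a A ha ih =>
    have hpa := (hp a (Finset.mem_insert_self a A)).1
    rw [sum_patternProb_insert p ha, Finset.sum_insert ha,
      ← ih fun i hi => hp i (Finset.mem_insert_of_mem hi)]
    have key : ∀ s ∈ A.powerset, patternProb p A s *
        ((1 - p a) * ∑ i ∈ insert a A, inclWeight p s i * b i +
          p a * ∑ i ∈ insert a A, inclWeight p (insert a s) i * b i) =
        patternProb p A s * b a + patternProb p A s * ∑ i ∈ A, inclWeight p s i * b i := by
      intro s hs
      have has : a ∉ s := fun h => ha (Finset.mem_powerset.1 hs h)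
      have e : ∑ i ∈ A, inclWeight p (insert a s) i * b i = ∑ i ∈ A, inclWeight p s i * b i :=
        Finset.sum_congr rfl fun i hi => by
          rw [inclWeight_insert_of_ne p s (ne_of_mem_of_not_mem hi ha)]
      rw [Finset.sum_insert ha, Finset.sum_insert ha, e]
      have w1 : inclWeight p s a = 0 := by simp [inclWeight, has]
      have w2 : inclWeight p (insert a s) a = (p a)⁻¹ := by simp [inclWeight]
      rw [w1, w2]
      field_simp
      ring
    rw [Finset.sum_congr rfl key, Finset.sum_add_distrib, ← Finset.sum_mul, sum_patternProb]
    ring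

/-- The conditional second moment of the weighted sample total, about its mean. -/
lemma sum_patternProb_mul_sq {H : Type*} [NormedAddCommGroup H] [InnerProductSpace ℝ H]
    {p : ℕ → ℝ} {A : Finset ℕ} (hp : ∀ i ∈ A, 0 < p i ∧ p i ≤ 1) (v : ℕ → H) (c : H) :
    ∑ s ∈ A.powerset, patternProb p A s * ‖c + ∑ i ∈ A, (inclWeight p s i - 1) • v i‖ ^ 2 =
      ‖c‖ ^ 2 + ∑ i ∈ A, ((p i)⁻¹ - 1) * ‖v i‖ ^ 2 := by
  -- The offset `c` is what lets the induction run: the outcome of the new unit is absorbed into it,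
  -- as `c - v a` when left out and `c + ((p a)⁻¹ - 1) • v a` when drawn. These shifts have mean
  -- zero, so the cross terms cancel.
  induction A using Finset.induction_on generalizing c with
  | empty => simp [patternProb]
  | insert a A ha ih =>
    have hpa := (hp a (Finset.mem_insert_self a A)).1
    have ih' := ih fun i hi => hp i (Finset.mem_insert_of_mem hi)
    rw [sum_patternProb_insert p ha, Finset.sum_insert ha]
    have key : ∀ s ∈ A.powerset, patternProb p A s *
        ((1 - p a) * ‖c + ∑ i ∈ insert a A, (inclWeight p s i - 1) • v i‖ ^ 2 +
          p a * ‖c + ∑ i ∈ insert a A, (inclWeight p (insert a s) i - 1) • v i‖ ^ 2) =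
        (1 - p a) * (patternProb p A s *
          ‖(c - v a) + ∑ i ∈ A, (inclWeight p s i - 1) • v i‖ ^ 2) +
        p a * (patternProb p A s *
          ‖(c + ((p a)⁻¹ - 1) • v a) + ∑ i ∈ A, (inclWeight p s i - 1) • v i‖ ^ 2) := by
      intro s hs
      have has : a ∉ s := fun h => ha (Finset.mem_powerset.1 hs h)
      have e : ∑ i ∈ A, (inclWeight p (insert a s) i - 1) • v i =
          ∑ i ∈ A, (inclWeight p s i - 1) • v i :=
        Finset.sum_congr rfl fun i hi => by
          rw [inclWeight_insert_of_ne p s (ne_of_mem_of_not_mem hi ha)]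
      have w1 : inclWeight p s a = 0 := by simp [inclWeight, has]
      have w2 : inclWeight p (insert a s) a = (p a)⁻¹ := by simp [inclWeight]
      rw [Finset.sum_insert ha, Finset.sum_insert ha, e, w1, w2, ← add_assoc, ← add_assoc,
        zero_sub, neg_one_smul, ← sub_eq_add_neg]
      ring
    rw [Finset.sum_congr rfl key, Finset.sum_add_distrib, ← Finset.mul_sum, ← Finset.mul_sum,
      ih', ih', norm_sub_sq_real, norm_add_sq_real, inner_smul_right, norm_smul, mul_pow,
      Real.norm_eq_abs, sq_abs]
    field_simp
    ring

lemma sum_patternProb_mul_sq_le {H : Type*} [NormedAddCommGroup H] [InnerProductSpace ℝ H]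
    {p : ℕ → ℝ} {A : Finset ℕ} (hp : ∀ i ∈ A, 0 < p i ∧ p i ≤ 1) (v : ℕ → H) :
    ∑ s ∈ A.powerset, patternProb p A s * ‖∑ i ∈ A, (inclWeight p s i - 1) • v i‖ ^ 2 ≤
      ∑ i ∈ A, (p i)⁻¹ * ‖v i‖ ^ 2 := by
  have h := sum_patternProb_mul_sq hp v 0
  simp only [zero_add, norm_zero, ne_eq, OfNat.ofNat_ne_zero, not_false_eq_true, zero_pow] at h
  rw [h]
  refine Finset.sum_le_sum fun i _ => ?_
  nlinarith [sq_nonneg ‖v i‖]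

/-! ### Conditional probabilities given the data as finite sums over inclusion patterns -/

variable {Ω : Type*} {d : ℕ}

lemma measurable_inclWeight {m : MeasurableSpace Ω} {p : ℕ → Ω → ℝ} {i : ℕ}
    (hp : Measurable (p i)) (s : Finset ℕ) : Measurable fun ω => inclWeight (fun i => p i ω) s i := by
  unfold inclWeight
  split_ifs
  · exact hp.inv
  · exact measurable_const

lemma measurable_sum_inclWeight {m : MeasurableSpace Ω} {H : Type*} [NormedAddCommGroup H]
    [NormedSpace ℝ H] [MeasurableSpace H] [BorelSpace H] [SecondCountableTopology H] {N : ℕ}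
    {p : ℕ → Ω → ℝ} {v : ℕ → Ω → H} (hp : ∀ i < N, Measurable (p i))
    (hv : ∀ i < N, Measurable (v i)) (s : Finset ℕ) (a : ℝ) :
    Measurable fun ω =>
      ∑ i ∈ Finset.range N, (inclWeight (fun i => p i ω) s i - a) • v i ω :=
  Finset.measurable_fun_sum _ fun i hi =>
    ((measurable_inclWeight (hp i (Finset.mem_range.1 hi)) s).sub_const a).smul
      (hv i (Finset.mem_range.1 hi))

lemma measurable_norm_sq_sum_inclWeight {m : MeasurableSpace Ω} {H : Type*}
    [NormedAddCommGroup H] [NormedSpace ℝ H] [MeasurableSpace H] [BorelSpace H]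
    [SecondCountableTopology H] {N : ℕ} {p : ℕ → Ω → ℝ} {v : ℕ → Ω → H}
    (hp : ∀ i < N, Measurable (p i)) (hv : ∀ i < N, Measurable (v i)) (s : Finset ℕ) (a : ℝ) :
    Measurable fun ω =>
      ‖∑ i ∈ Finset.range N, (inclWeight (fun i => p i ω) s i - a) • v i ω‖ ^ 2 :=
  (measurable_sum_inclWeight hp hv s a).norm.pow_const 2

lemma measurable_dataSigma_pair (x : ℕ → Ω → Vec d) (y : ℕ → Ω → ℝ) {N i : ℕ} (hi : i < N) :
    Measurable[dataSigma x y N] fun ω => (x i ω, y i ω) := by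
  have h : Measurable[dataSigma x y N] fun ω (i : Fin N) => (x i ω, y i ω) :=
    comap_measurable _
  exact (measurable_pi_apply (⟨i, hi⟩ : Fin N)).comp h

/-- The set of units which are included in the sample. -/
def inclSet (N : ℕ) (δ : ℕ → Ω → Bool) (ω : Ω) : Finset ℕ :=
  (Finset.range N).filter fun i => δ i ω = true

lemma inclSet_eq_iff {N : ℕ} {δ : ℕ → Ω → Bool} {ω : Ω} {s : Finset ℕ}
    (hs : s ⊆ Finset.range N) :
    inclSet N δ ω = s ↔ ∀ i ∈ Finset.range N, (δ i ω = true ↔ i ∈ s) := by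
  constructor
  · rintro rfl i hi
    simp only [inclSet, Finset.mem_filter, hi, true_and]
  · intro h
    ext i
    simp only [inclSet, Finset.mem_filter]
    exact ⟨fun hi => (h i hi.1).1 hi.2, fun hi => ⟨hs hi, (h i (hs hi)).2 hi⟩⟩

variable [mΩ : MeasurableSpace Ω]

lemma dataSigma_le {x : ℕ → Ω → Vec d} {y : ℕ → Ω → ℝ} (hx : ∀ i, Measurable (x i))
    (hy : ∀ i, Measurable (y i)) (N : ℕ) : dataSigma x y N ≤ mΩ := by
  refine Measurable.comap_le ?_
  exact measurable_pi_lambda _ fun i => (hx i).prodMk (hy i)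

lemma measurableSet_inclSet_eq {N : ℕ} {δ : ℕ → Ω → Bool} (hδ : ∀ i < N, Measurable (δ i))
    {s : Finset ℕ} (hs : s ⊆ Finset.range N) : MeasurableSet {ω | inclSet N δ ω = s} := by
  simp only [inclSet_eq_iff hs]
  have : {ω | ∀ i ∈ Finset.range N, (δ i ω = true ↔ i ∈ s)} =
      ⋂ i ∈ Finset.range N, {ω | (δ i ω = true ↔ i ∈ s)} := by
    ext ω; simp
  rw [this]
  refine Finset.measurableSet_biInter _ fun i hi => ?_
  exact hδ i (Finset.mem_range.1 hi) (MeasurableSet.of_discrete (s := {b | (b = true ↔ i ∈ s)}))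

lemma measurableSet_mem_inclSet {N : ℕ} {δ : ℕ → Ω → Bool} (hδ : ∀ i < N, Measurable (δ i))
    {G : Finset ℕ → Set Ω} (hG : ∀ s, MeasurableSet (G s)) :
    MeasurableSet {ω | ω ∈ G (inclSet N δ ω)} := by
  have : {ω | ω ∈ G (inclSet N δ ω)} =
      ⋃ s ∈ (Finset.range N).powerset, {ω | inclSet N δ ω = s} ∩ G s := by
    ext ω
    simp [inclSet]
  rw [this]
  exact Finset.measurableSet_biUnion _ fun s hs =>
    (measurableSet_inclSet_eq hδ (Finset.mem_powerset.1 hs)).inter (hG s)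

variable {μ : Measure Ω} [IsProbabilityMeasure μ]

/-- Given the data, the conditional probability of an event which depends on the data and on the
sample is a finite sum over inclusion patterns. -/
lemma condProbData_inclSet {x : ℕ → Ω → Vec d} {y : ℕ → Ω → ℝ} {N : ℕ} {p : ℕ → Ω → ℝ}
    {δ : ℕ → Ω → Bool} (hx : ∀ i, Measurable (x i)) (hy : ∀ i, Measurable (y i))
    (h : IsPoissonSubsample μ x y N p δ) (G : Finset ℕ → Set Ω)
    (hG : ∀ s, MeasurableSet[dataSigma x y N] (G s)) :
    condProbData μ x y N {ω | ω ∈ G (inclSet N δ ω)} =ᵐ[μ] fun ω =>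
      ∑ s ∈ (Finset.range N).powerset,
        (G s).indicator (fun ω => patternProb (fun i => p i ω) (Finset.range N) s) ω := by
  have hm := dataSigma_le hx hy N
  have hD : ∀ s ∈ (Finset.range N).powerset, MeasurableSet {ω | inclSet N δ ω = s} := fun s hs =>
    measurableSet_inclSet_eq h.measurable_incl (Finset.mem_powerset.1 hs)
  -- The event splits over the realized pattern. Each `G s` is measurable for the data, so its
  -- indicator leaves the conditional expectation and only the law of the pattern remains.
  have e : ({ω | ω ∈ G (inclSet N δ ω)}).indicator (fun _ => (1 : ℝ)) =
      ∑ s ∈ (Finset.range N).powerset, (G s).indicator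
        (({ω | inclSet N δ ω = s}).indicator fun _ => (1 : ℝ)) := by
    ext ω
    rw [Finset.sum_apply, Finset.sum_eq_single (inclSet N δ ω)]
    · rw [Set.indicator, Set.indicator, Set.indicator]
      simp
    · intro s _ hs
      have hn : ω ∉ {ω | inclSet N δ ω = s} := fun h => hs h.symm
      exact Set.indicator_apply_eq_zero.2 fun _ => Set.indicator_of_notMem hn _
    · intro hn
      exact absurd (Finset.mem_powerset.2 (Finset.filter_subset _ _)) hn
  have hint : ∀ s ∈ (Finset.range N).powerset,
      Integrable (({ω | inclSet N δ ω = s}).indicator fun _ => (1 : ℝ)) μ := fun s hs =>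
    (integrable_const _).indicator (hD s hs)
  have h1 : condProbData μ x y N {ω | ω ∈ G (inclSet N δ ω)} =ᵐ[μ]
      ∑ s ∈ (Finset.range N).powerset, μ[(G s).indicator
        (({ω | inclSet N δ ω = s}).indicator fun _ => (1 : ℝ)) | dataSigma x y N] := by
    unfold condProbData
    rw [e]
    exact condExp_finsetSum (fun s hs => (hint s hs).indicator (hm _ (hG s))) _
  have h2 : ∀ᵐ ω ∂μ, ∀ s ∈ (Finset.range N).powerset, (μ[(G s).indicator
        (({ω | inclSet N δ ω = s}).indicator fun _ => (1 : ℝ)) | dataSigma x y N]) ω =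
      (G s).indicator (fun ω => patternProb (fun i => p i ω) (Finset.range N) s) ω := by
    refine (ae_ball_iff (Finset.countable_toSet _)).2 fun s hs => ?_
    have hs' := Finset.mem_powerset.1 hs
    have hlaw := h.cond_law s hs'
    have hset : {ω | ∀ i ∈ Finset.range N, (δ i ω = true ↔ i ∈ s)} = {ω | inclSet N δ ω = s} := by
      ext ω
      exact (inclSet_eq_iff hs').symm
    rw [hset] at hlaw
    filter_upwards [condExp_indicator (hint s hs) (hG s), hlaw] with ω ha hb
    rw [ha]
    by_cases hω : ω ∈ G s
    · rw [Set.indicator_of_mem hω, Set.indicator_of_mem hω]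
      exact hb
    · rw [Set.indicator_of_notMem hω, Set.indicator_of_notMem hω]
  filter_upwards [h1, h2] with ω ha hb
  rw [ha, Finset.sum_apply]
  exact Finset.sum_congr rfl hb

/-- Markov's inequality given the data, for functions of the data and the sample. -/
lemma condProbData_markov {x : ℕ → Ω → Vec d} {y : ℕ → Ω → ℝ} {N : ℕ} {p : ℕ → Ω → ℝ}
    {δ : ℕ → Ω → Bool} (hx : ∀ i, Measurable (x i)) (hy : ∀ i, Measurable (y i))
    (h : IsPoissonSubsample μ x y N p δ) {f : Finset ℕ → Ω → ℝ} {t : Ω → ℝ}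
    (hf : ∀ s, Measurable[dataSigma x y N] (f s)) (ht : Measurable[dataSigma x y N] t)
    (hf0 : ∀ s ω, 0 ≤ f s ω) :
    ∀ᵐ ω ∂μ, 0 < t ω → condProbData μ x y N {ω | t ω ≤ f (inclSet N δ ω) ω} ω ≤
      (∑ s ∈ (Finset.range N).powerset,
        patternProb (fun i => p i ω) (Finset.range N) s * f s ω) / t ω := by
  have hG : ∀ s, MeasurableSet[dataSigma x y N] {ω | t ω ≤ f s ω} := fun s =>
    by exact measurableSet_le ht (hf s)
  filter_upwards [condProbData_inclSet hx hy h (fun s => {ω | t ω ≤ f s ω}) hG] with ω hω htω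
  have hω' : condProbData μ x y N {ω | t ω ≤ f (inclSet N δ ω) ω} ω = _ := hω
  rw [hω', Finset.sum_div]
  refine Finset.sum_le_sum fun s _ => ?_
  have hp : 0 ≤ patternProb (fun i => p i ω) (Finset.range N) s :=
    patternProb_nonneg (fun i hi => h.prob_mem i (Finset.mem_range.1 hi) ω) s
  by_cases hs : t ω ≤ f s ω
  · rw [Set.indicator_of_mem (show ω ∈ {ω | t ω ≤ f s ω} from hs), mul_div_assoc]
    exact le_mul_of_one_le_right hp ((one_le_div htω).2 hs)
  · rw [Set.indicator_of_notMem (show ω ∉ {ω | t ω ≤ f s ω} from hs)]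
    exact div_nonneg (mul_nonneg hp (hf0 s ω)) htω.le

/-- Chebyshev's inequality given the data, for weighted sample totals. -/
lemma condProbData_chebyshev {H : Type*} [NormedAddCommGroup H] [InnerProductSpace ℝ H]
    [MeasurableSpace H] [BorelSpace H] [SecondCountableTopology H]
    {x : ℕ → Ω → Vec d} {y : ℕ → Ω → ℝ} {N : ℕ} {p : ℕ → Ω → ℝ}
    {δ : ℕ → Ω → Bool} (hx : ∀ i, Measurable (x i)) (hy : ∀ i, Measurable (y i))
    (h : IsPoissonSubsample μ x y N p δ) {v : ℕ → Ω → H} {t : Ω → ℝ}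
    (hv : ∀ i < N, Measurable[dataSigma x y N] (v i)) (ht : Measurable[dataSigma x y N] t) :
    ∀ᵐ ω ∂μ, 0 < t ω → condProbData μ x y N {ω | t ω ^ 2 ≤
        ‖∑ i ∈ Finset.range N, (inclWeight (fun i => p i ω) (inclSet N δ ω) i - 1) • v i ω‖ ^ 2} ω ≤
      (∑ i ∈ Finset.range N, (p i ω)⁻¹ * ‖v i ω‖ ^ 2) / t ω ^ 2 := by
  have hf : ∀ s, Measurable[dataSigma x y N] fun ω =>
      ‖∑ i ∈ Finset.range N, (inclWeight (fun i => p i ω) s i - 1) • v i ω‖ ^ 2 := fun s =>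
    measurable_norm_sq_sum_inclWeight h.measurable_prob hv s 1
  filter_upwards [condProbData_markov hx hy h hf (ht.pow_const 2) fun s ω => sq_nonneg _]
    with ω hω htω
  refine (hω (by positivity)).trans ?_
  gcongr
  exact sum_patternProb_mul_sq_le (fun i hi => h.prob_mem i (Finset.mem_range.1 hi) ω) _

/-- Markov's inequality given the data, for weighted sample totals of nonnegative quantities. -/
lemma condProbData_markov_total {x : ℕ → Ω → Vec d} {y : ℕ → Ω → ℝ} {N : ℕ} {p : ℕ → Ω → ℝ}
    {δ : ℕ → Ω → Bool} (hx : ∀ i, Measurable (x i)) (hy : ∀ i, Measurable (y i))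
    (h : IsPoissonSubsample μ x y N p δ) {b : ℕ → Ω → ℝ} {t : ℝ}
    (hb : ∀ i < N, Measurable[dataSigma x y N] (b i)) (hb0 : ∀ i ω, 0 ≤ b i ω) :
    ∀ᵐ ω ∂μ, 0 < t → condProbData μ x y N {ω | t ≤
        ∑ i ∈ Finset.range N, inclWeight (fun i => p i ω) (inclSet N δ ω) i * b i ω} ω ≤
      (∑ i ∈ Finset.range N, b i ω) / t := by
  have hf : ∀ s, Measurable[dataSigma x y N] fun ω =>
      ∑ i ∈ Finset.range N, inclWeight (fun i => p i ω) s i * b i ω := fun s => by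
    have := measurable_sum_inclWeight (m := dataSigma x y N) h.measurable_prob hb s 0
    simpa only [sub_zero, smul_eq_mul] using this
  filter_upwards [condProbData_markov hx hy h hf (@measurable_const _ _ _ (dataSigma x y N) t)
    fun s ω => Finset.sum_nonneg fun i hi => mul_nonneg (inclWeight_nonneg
      (fun i hi => h.prob_mem i (Finset.mem_range.1 hi) ω) s hi) (hb0 i ω)] with ω hω ht
  refine (hω ht).trans_eq ?_
  rw [sum_patternProb_mul_total fun i hi => h.prob_mem i (Finset.mem_range.1 hi) ω]

end

/-! ### Deterministic analysis of weighted scores -/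

section


section Score

variable {E : Type*} [NormedAddCommGroup E] [InnerProductSpace ℝ E]

/-- The quasi-score with weights `w`. -/
noncomputable def totalScore (ψ : ℝ → ℝ) (A : Finset ℕ) (w : ℕ → ℝ) (z : ℕ → E) (y : ℕ → ℝ)
    (β : E) : E :=
  ∑ i ∈ A, (w i * (y i - ψ (inner ℝ β (z i)))) • z i

variable {ψ : ℝ → ℝ} {A : Finset ℕ} {w : ℕ → ℝ} {z : ℕ → E} {y : ℕ → ℝ}

lemma inner_totalScore (β v : E) : inner ℝ (totalScore ψ A w z y β) v =
    ∑ i ∈ A, w i * (y i - ψ (inner ℝ β (z i))) * inner ℝ v (z i) := by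
  simp only [totalScore, sum_inner, inner_smul_left, RCLike.conj_to_real, real_inner_comm (z _) v]

lemma totalScore_sub (w' : ℕ → ℝ) (β : E) :
    totalScore ψ A w z y β - totalScore ψ A w' z y β =
      ∑ i ∈ A, (w i - w' i) • ((y i - ψ (inner ℝ β (z i))) • z i) := by
  simp only [totalScore, ← Finset.sum_sub_distrib, ← sub_smul, smul_smul, ← sub_mul]

/-- Each summand depends on `t` through `-ψ(… + t⟨v, z i⟩) * ⟨v, z i⟩`, which decreases whichever
sign `⟨v, z i⟩` has. -/
lemma antitone_inner_totalScore (hψ : Monotone ψ) (hw : ∀ i ∈ A, 0 ≤ w i) (b v : E) :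
    Antitone fun t : ℝ => inner ℝ (totalScore ψ A w z y (b + t • v)) v := by
  intro s t hst
  simp only [inner_totalScore, inner_add_left, inner_smul_left, RCLike.conj_to_real]
  refine Finset.sum_le_sum fun i hi => ?_
  have hwi := hw i hi
  rw [mul_assoc, mul_assoc]
  refine mul_le_mul_of_nonneg_left ?_ hwi
  rcases le_total 0 (inner ℝ v (z i)) with h | h
  · have := hψ (add_le_add_right (mul_le_mul_of_nonneg_right hst h) (inner ℝ b (z i)))
    nlinarith
  · have := hψ (add_le_add_right (mul_le_mul_of_nonpos_right hst h) (inner ℝ b (z i)))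
    nlinarith

/-- The mean value theorem for the scalar function `t ↦ ⟨score (b + t • v), v⟩`; contracting with
`v` first avoids a vector-valued mean value theorem, and the remainder is a quadratic form at one
intermediate point. -/
lemma exists_inner_totalScore_eq (hψ : Differentiable ℝ ψ) (b v : E) :
    ∃ t ∈ Set.Ioo (0 : ℝ) 1, inner ℝ (totalScore ψ A w z y (b + v)) v =
      inner ℝ (totalScore ψ A w z y b) v -
        ∑ i ∈ A, w i * (deriv ψ (inner ℝ (b + t • v) (z i)) * inner ℝ v (z i) ^ 2) := by
  have hd : ∀ t : ℝ, HasDerivAt (fun t : ℝ => inner ℝ (totalScore ψ A w z y (b + t • v)) v)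
      (-∑ i ∈ A, w i * (deriv ψ (inner ℝ (b + t • v) (z i)) * inner ℝ v (z i) ^ 2)) t := by
    intro t
    simp only [inner_totalScore, ← Finset.sum_neg_distrib]
    refine HasDerivAt.fun_sum fun i _ => ?_
    have h1 : HasDerivAt (fun t : ℝ => inner ℝ (b + t • v) (z i)) (inner ℝ v (z i)) t := by
      simp only [inner_add_left, inner_smul_left, RCLike.conj_to_real]
      simpa using ((hasDerivAt_id t).mul_const (inner ℝ v (z i))).const_add (inner ℝ b (z i))
    have h2 := ((((hψ _).hasDerivAt.comp t h1).const_sub (y i)).const_mul (w i)).mul_const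
      (inner ℝ v (z i))
    refine h2.congr_deriv ?_
    ring
  obtain ⟨t, ht, h⟩ := exists_hasDerivAt_eq_slope _ _ (zero_lt_one' ℝ)
    (fun t _ => (hd t).continuousAt.continuousWithinAt) (fun t _ => hd t)
  refine ⟨t, ht, ?_⟩
  simp only [one_smul, zero_smul, add_zero, sub_zero, div_one] at h
  linarith

/-- A zero on or beyond the sphere has radial component zero, so by monotonicity along the ray the
radial component where that ray meets the sphere would be nonnegative. -/
lemma norm_sub_lt_of_totalScore_eq_zero (hψ : Monotone ψ) (hw : ∀ i ∈ A, 0 ≤ w i) {b : E}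
    {ρ : ℝ} (hρ : 0 < ρ)
    (h : ∀ v : E, ‖v‖ = ρ → inner ℝ (totalScore ψ A w z y (b + v)) v < 0) {β : E}
    (hβ : totalScore ψ A w z y β = 0) : ‖β - b‖ < ρ := by
  by_contra! hcon
  have hpos : 0 < ‖β - b‖ := hρ.trans_le hcon
  set a := ρ / ‖β - b‖ with ha
  have ha0 : 0 < a := by positivity
  have ha1 : a ≤ 1 := (div_le_one hpos).2 hcon
  have h1 := h (a • (β - b)) (by
    rw [norm_smul, Real.norm_of_nonneg ha0.le, ha, div_mul_cancel₀ _ hpos.ne'])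
  have h2 := antitone_inner_totalScore (y := y) (z := z) hψ hw b (β - b) ha1
  simp only [one_smul, add_sub_cancel, hβ, inner_zero_left] at h2
  rw [inner_smul_right] at h1
  nlinarith

/-- Variational replacement for a fixed point theorem: the score is minus a gradient, and a
minimizer of the potential over the ball cannot sit on the boundary. -/
lemma exists_totalScore_eq_zero [FiniteDimensional ℝ E] (hψ : Continuous ψ) {b : E} {ρ : ℝ}
    (hρ : 0 < ρ) (h : ∀ v : E, ‖v‖ = ρ → inner ℝ (totalScore ψ A w z y (b + v)) v < 0) :
    ∃ β ∈ Metric.closedBall b ρ, totalScore ψ A w z y β = 0 := by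
  have : ProperSpace E := FiniteDimensional.proper_real E
  -- The negative weighted quasi-log-likelihood, with the primitive of `ψ` as cumulant function.
  set F : E → ℝ := fun β => ∑ i ∈ A,
    w i * ((∫ u in (0 : ℝ)..inner ℝ β (z i), ψ u) - y i * inner ℝ β (z i)) with hF
  have hFd : ∀ β, HasFDerivAt F (-innerSL ℝ (totalScore ψ A w z y β)) β := by
    intro β
    have h1 : ∀ i ∈ A, HasFDerivAt (fun β : E =>
        w i * ((∫ u in (0 : ℝ)..inner ℝ β (z i), ψ u) - y i * inner ℝ β (z i)))
        (w i • (ψ (inner ℝ β (z i)) • innerSL ℝ (z i) - y i • innerSL ℝ (z i))) β := by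
      intro i _
      have hin : HasFDerivAt (fun β : E => inner ℝ β (z i)) (innerSL ℝ (z i)) β := by
        have h := (innerSL ℝ (z i)).hasFDerivAt (x := β)
        have e : (fun β : E => inner ℝ β (z i)) = innerSL ℝ (z i) :=
          funext fun β => (real_inner_comm _ _).trans (innerSL_apply_apply ℝ _ _).symm
        rwa [← e] at h
      have hint := (hψ.integral_hasStrictDerivAt 0 (inner ℝ β (z i))).hasDerivAt
      exact ((hint.comp_hasFDerivAt β hin).sub (hin.const_mul (y i))).const_mul (w i)
    refine (HasFDerivAt.fun_sum h1).congr_fderiv ?_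
    ext v
    simp only [sum_apply, smul_apply,
      sub_apply, neg_apply, innerSL_apply_apply,
      inner_totalScore, smul_eq_mul, ← Finset.sum_neg_distrib, real_inner_comm v (z _)]
    refine Finset.sum_congr rfl fun i _ => ?_
    ring
  obtain ⟨β, hβ, hmin⟩ := (isCompact_closedBall b ρ).exists_isMinOn
    ⟨b, Metric.mem_closedBall_self hρ.le⟩
    (fun β _ => (hFd β).continuousAt.continuousWithinAt)
  refine ⟨β, hβ, ?_⟩
  have hle : ‖β - b‖ ≤ ρ := by simpa [dist_eq_norm] using hβ
  rcases hle.eq_or_lt with heq | hlt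
  -- At a boundary minimizer the derivative of `F` towards the centre is nonnegative, which
  -- contradicts the score pointing inward.
  · exfalso
    have h1 := h (β - b) heq
    rw [add_sub_cancel] at h1
    have hseg : segment ℝ β b ⊆ Metric.closedBall b ρ :=
      (convex_closedBall b ρ).segment_subset hβ (Metric.mem_closedBall_self hρ.le)
    have h2 := hmin.localize.hasFDerivWithinAt_nonneg (hFd β).hasFDerivWithinAt
      (sub_mem_posTangentConeAt_of_segment_subset hseg)
    rw [neg_apply, innerSL_apply_apply, ← neg_sub, inner_neg_right,
      neg_neg] at h2
    linarith
  · have hnhds : Metric.closedBall b ρ ∈ 𝓝 β :=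
      Filter.mem_of_superset (Metric.isOpen_ball.mem_nhds (by simpa [dist_eq_norm] using hlt))
        Metric.ball_subset_closedBall
    have h0 := (hmin.isLocalMin hnhds).hasFDerivAt_eq_zero (hFd β)
    have := congrArg (fun L : E →L[ℝ] ℝ => L (totalScore ψ A w z y β)) h0
    simpa using this

end Score

/-! ### Information matrix, its quadratic form, and localization of the zeros -/

variable {d : ℕ}

lemma weightedScore_eq_totalScore (ψ : ℝ → ℝ) (xs : ℕ → Vec d) (ys : ℕ → ℝ) (N : ℕ)
    (ps : ℕ → ℝ) (ds : ℕ → Bool) (β : Vec d) :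
    weightedScore ψ xs ys N ps ds β = totalScore ψ (Finset.range N)
      (inclWeight ps ((Finset.range N).filter fun i => ds i = true)) xs ys β := by
  unfold weightedScore totalScore
  rw [Finset.sum_filter]
  refine Finset.sum_congr rfl fun i hi => ?_
  simp only [inclWeight, Finset.mem_filter, hi, true_and]
  split_ifs <;> simp

lemma quasiScore_eq_totalScore (ψ : ℝ → ℝ) (xs : ℕ → Vec d) (ys : ℕ → ℝ) (N : ℕ) (β : Vec d) :
    quasiScore ψ xs ys N β = totalScore ψ (Finset.range N) 1 xs ys β := by
  simp [quasiScore, totalScore]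

lemma inner_toEuclideanCLM_infoTerm (ψ : ℝ → ℝ) (β v u : Vec d) :
    inner ℝ u (Matrix.toEuclideanCLM (n := Fin d) (𝕜 := ℝ) (infoTerm ψ β v) u) =
      deriv ψ (inner ℝ β v) * inner ℝ u v ^ 2 := by
  have h : Matrix.toEuclideanCLM (n := Fin d) (𝕜 := ℝ) (infoTerm ψ β v) u =
      (deriv ψ (inner ℝ β v) * inner ℝ u v) • v := by
    ext j
    simp only [infoTerm, map_smul, smul_apply, PiLp.smul_apply,
      Matrix.ofLp_toEuclideanCLM, smul_eq_mul, Matrix.vecMulVec_mulVec, Pi.smul_apply,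
      MulOpposite.smul_eq_mul_unop, MulOpposite.unop_op, PiLp.inner_apply, dotProduct]
    simp only [RCLike.inner_apply, conj_trivial]
    ring
  rw [h, inner_smul_right]
  ring

lemma abs_deriv_mul_sq_sub_le (ψ : ℝ → ℝ) (β β' v u : Vec d) :
    |deriv ψ (inner ℝ β v) * inner ℝ u v ^ 2 - deriv ψ (inner ℝ β' v) * inner ℝ u v ^ 2| ≤
      spectralNorm (infoTerm ψ β v - infoTerm ψ β' v) * ‖u‖ ^ 2 := by
  rw [← inner_toEuclideanCLM_infoTerm, ← inner_toEuclideanCLM_infoTerm, ← inner_sub_right,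
    ← sub_apply, ← map_sub]
  refine (abs_real_inner_le_norm _ _).trans ?_
  have := (Matrix.toEuclideanCLM (n := Fin d) (𝕜 := ℝ)
    (infoTerm ψ β v - infoTerm ψ β' v)).le_opNorm u
  unfold spectralNorm
  nlinarith [norm_nonneg u]

lemma isHermitian_infoMatrix (ψ : ℝ → ℝ) (xs : ℕ → Vec d) (N : ℕ) (β : Vec d) :
    (infoMatrix ψ xs N β).IsHermitian := by
  have h : ∀ i, (infoTerm ψ β (xs i)).transpose = infoTerm ψ β (xs i) := fun i => by
    ext j k
    simp [infoTerm, Matrix.vecMulVec_apply, mul_comm]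
  rw [Matrix.IsHermitian, Matrix.conjTranspose_eq_transpose_of_trivial, infoMatrix,
    Matrix.transpose_smul, Matrix.transpose_sum]
  simp only [h]

/-- Subtracting `c` times the identity shifts the spectrum of the symmetric matrix to the
nonnegative half-line, so the difference is positive semidefinite. -/
lemma mul_norm_sq_le_of_spectrum (ψ : ℝ → ℝ) (xs : ℕ → Vec d) (N : ℕ) (β : Vec d) {c : ℝ}
    (h : ∀ lam ∈ spectrum ℝ (infoMatrix ψ xs N β), c ≤ lam) (u : Vec d) :
    c * ‖u‖ ^ 2 ≤ (N : ℝ)⁻¹ * ∑ i ∈ Finset.range N,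
      deriv ψ (inner ℝ β (xs i)) * inner ℝ u (xs i) ^ 2 := by
  set M := infoMatrix ψ xs N β with hM
  have hpos : (M - algebraMap ℝ _ c).PosSemidef := by
    rw [Matrix.posSemidef_iff_isHermitian_and_spectrum_nonneg]
    refine ⟨(isHermitian_infoMatrix ψ xs N β).sub ?_, ?_⟩
    · rw [Matrix.IsHermitian, Matrix.conjTranspose_eq_transpose_of_trivial,
        Matrix.algebraMap_eq_diagonal, Matrix.diagonal_transpose]
    · intro a ha
      rw [← spectrum.sub_singleton_eq] at ha
      obtain ⟨lam, hlam, c', hc', rfl⟩ := Set.mem_sub.1 ha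
      rw [Set.mem_singleton_iff] at hc'
      have := h lam hlam
      simp only [Set.mem_ofPred_eq]
      linarith
  have hquad := hpos.dotProduct_mulVec_nonneg u.ofLp
  have e : inner ℝ u (Matrix.toEuclideanCLM (n := Fin d) (𝕜 := ℝ) M u) =
      (N : ℝ)⁻¹ * ∑ i ∈ Finset.range N, deriv ψ (inner ℝ β (xs i)) * inner ℝ u (xs i) ^ 2 := by
    simp only [← inner_toEuclideanCLM_infoTerm]
    rw [hM, infoMatrix, map_smul, map_sum, smul_apply,
      sum_apply, inner_smul_right, inner_sum]
  rw [← e]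
  have e2 : inner ℝ u (Matrix.toEuclideanCLM (n := Fin d) (𝕜 := ℝ) M u) - c * ‖u‖ ^ 2 =
      star u.ofLp ⬝ᵥ (M - algebraMap ℝ _ c).mulVec u.ofLp := by
    rw [Matrix.sub_mulVec, dotProduct_sub, Algebra.algebraMap_eq_smul_one, Matrix.smul_mulVec,
      Matrix.one_mulVec, ← real_inner_self_eq_norm_sq]
    simp only [PiLp.inner_apply, Matrix.ofLp_toEuclideanCLM, dotProduct, Finset.mul_sum,
      Pi.smul_apply, smul_eq_mul, RCLike.inner_apply, conj_trivial, star_trivial]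
    congr 1 <;> refine Finset.sum_congr rfl fun i _ => ?_ <;> ring
  linarith

/-- The entries of the matrix `v vᵀ` as a vector, so that the Euclidean norm is the Frobenius
norm. -/
noncomputable def outerVec (v : Vec d) : EuclideanSpace ℝ (Fin d × Fin d) :=
  WithLp.toLp 2 fun jk => v jk.1 * v jk.2

/-- Makes the quadratic form linear in the data: a single Frobenius-norm bound on a sum of `outerVec
(x i)` then controls all directions `u` at once, and Chebyshev applies in a Hilbert space. -/
lemma inner_outerVec (u v : Vec d) : inner ℝ (outerVec u) (outerVec v) = inner ℝ u v ^ 2 := by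
  simp only [outerVec, PiLp.inner_apply, RCLike.inner_apply, conj_trivial, sq, Finset.sum_mul_sum,
    Fintype.sum_prod_type]
  refine Finset.sum_congr rfl fun i _ => Finset.sum_congr rfl fun j _ => ?_
  ring

lemma norm_outerVec (v : Vec d) : ‖outerVec v‖ = ‖v‖ ^ 2 := by
  have h := inner_outerVec v v
  rw [real_inner_self_eq_norm_sq, real_inner_self_eq_norm_sq] at h
  exact (sq_eq_sq₀ (norm_nonneg _) (sq_nonneg _)).1 h

lemma convex_paramBall (d : ℕ) (B : ℝ) : Convex ℝ (paramBall d B) := by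
  intro u hu v hv a b ha hb hab
  have hu' : ∑ j, |u j| ≤ B := hu
  have hv' : ∑ j, |v j| ≤ B := hv
  calc ∑ j, |(a • u + b • v) j| ≤ ∑ j, (a * |u j| + b * |v j|) := by
        refine Finset.sum_le_sum fun j _ => ?_
        simp only [PiLp.add_apply, PiLp.smul_apply, smul_eq_mul]
        refine (abs_add_le _ _).trans ?_
        rw [abs_mul, abs_mul, abs_of_nonneg ha, abs_of_nonneg hb]
    _ = a * ∑ j, |u j| + b * ∑ j, |v j| := by
        rw [Finset.sum_add_distrib, Finset.mul_sum, Finset.mul_sum]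
    _ ≤ a * B + b * B := by gcongr
    _ = B := by rw [← add_mul, hab, one_mul]

/-- A zero of the full-data score is close to `b₀` when the score at `b₀` is small. -/
lemma mul_norm_sub_le_of_quasiScore_eq_zero {ψ : ℝ → ℝ} (hψ : Differentiable ℝ ψ) {B : ℝ} {N : ℕ}
    (hN : 0 < N) {xs : ℕ → Vec d} {ys : ℕ → ℝ} {b b₀ : Vec d} {c : ℝ}
    (hquad : ∀ β ∈ paramBall d B, ∀ u : Vec d, c * ‖u‖ ^ 2 ≤ (N : ℝ)⁻¹ *
      ∑ i ∈ Finset.range N, deriv ψ (inner ℝ β (xs i)) * inner ℝ u (xs i) ^ 2)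
    (hb : b ∈ paramBall d B) (hb₀ : b₀ ∈ paramBall d B) (hzero : quasiScore ψ xs ys N b = 0) :
    c * ‖b - b₀‖ ≤ ‖(N : ℝ)⁻¹ • quasiScore ψ xs ys N b₀‖ := by
  have hN' : (0 : ℝ) < N := by exact_mod_cast hN
  rw [quasiScore_eq_totalScore] at *
  obtain ⟨t, ht, h⟩ := exists_inner_totalScore_eq (A := Finset.range N) (w := 1) (z := xs)
    (y := ys) hψ b₀ (b - b₀)
  rw [add_sub_cancel, hzero, inner_zero_left] at h
  have hmem : b₀ + t • (b - b₀) ∈ paramBall d B :=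
    (convex_paramBall d B).add_smul_sub_mem hb₀ hb ⟨ht.1.le, ht.2.le⟩
  have h1 := hquad _ hmem (b - b₀)
  simp only [Pi.one_apply, one_mul] at h
  have h2 := real_inner_le_norm (totalScore ψ (Finset.range N) 1 xs ys b₀) (b - b₀)
  rw [norm_smul, norm_inv, Real.norm_of_nonneg hN'.le, inv_mul_eq_div, le_div_iff₀ hN']
  rw [inv_mul_eq_div, le_div_iff₀ hN'] at h1
  rcases (norm_nonneg (b - b₀)).eq_or_lt with h0 | h0
  · rw [← h0]
    simp
  · refine le_of_mul_le_mul_right ?_ h0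
    nlinarith

/-- If the subsample score is close to the full-data score, then it has a zero in the parameter
space, and all its zeros are close to the zero of the full-data score. -/
theorem exists_zero_and_norm_sub_lt {ψ : ℝ → ℝ} (hψ : ContDiff ℝ 2 ψ)
    (hψ' : ∀ t, 0 < deriv ψ t) {B : ℝ} {N : ℕ} {xs : ℕ → Vec d} {ys w m : ℕ → ℝ}
    {b b₀ : Vec d} {c κ ρ K : ℝ} (hw : ∀ i ∈ Finset.range N, 0 ≤ w i)
    (hρ : 0 < ρ) (hρκ : ρ ≤ κ) (hb : ‖b - b₀‖ < κ)
    (hball : Metric.closedBall b₀ (2 * κ) ⊆ paramBall d B)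
    (hquad : ∀ u : Vec d, c * ‖u‖ ^ 2 * N ≤
      ∑ i ∈ Finset.range N, deriv ψ (inner ℝ b₀ (xs i)) * inner ℝ u (xs i) ^ 2)
    (hfrob : ‖∑ i ∈ Finset.range N,
      (w i - 1) • (deriv ψ (inner ℝ b₀ (xs i)) • outerVec (xs i))‖ < c / 4 * N)
    (hlip : ∀ i ∈ Finset.range N, ∀ β ∈ paramBall d B,
      spectralNorm (infoTerm ψ β (xs i) - infoTerm ψ b₀ (xs i)) ≤ m i * ‖β - b₀‖)
    (hm : ∑ i ∈ Finset.range N, w i * |m i| < K * N) (hK : 2 * κ * K ≤ c / 4)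
    (hzero : quasiScore ψ xs ys N b = 0)
    (hscore : ‖∑ i ∈ Finset.range N, (w i - 1) • ((ys i - ψ (inner ℝ b (xs i))) • xs i)‖ <
      c / 2 * ρ * N) :
    (∃ β ∈ paramBall d B, totalScore ψ (Finset.range N) w xs ys β = 0) ∧
      ∀ β, totalScore ψ (Finset.range N) w xs ys β = 0 → ‖β - b‖ < ρ := by
  have hmono : Monotone ψ := (strictMono_of_deriv_pos hψ').monotone
  have hdiff : Differentiable ℝ ψ := hψ.differentiable (by norm_num)
  have hκ : 0 < κ := hρ.trans_le hρκ
  have hsphere : ∀ v : Vec d, ‖v‖ = ρ →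
      inner ℝ (totalScore ψ (Finset.range N) w xs ys (b + v)) v < 0 := by
    intro v hv
    obtain ⟨t, ht, h⟩ := exists_inner_totalScore_eq (A := Finset.range N) (w := w) (z := xs)
      (y := ys) hdiff b v
    rw [h]
    set b' := b + t • v with hb'
    -- One `κ` comes from the distance of `b` to `b₀`, the other from `ρ ≤ κ`.
    have hdist : ‖b' - b₀‖ ≤ 2 * κ := by
      have e : b' - b₀ = (b - b₀) + t • v := by rw [hb']; abel
      rw [e]
      refine (norm_add_le _ _).trans ?_
      rw [norm_smul, hv, Real.norm_of_nonneg ht.1.le]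
      nlinarith [ht.2]
    have hmem : b' ∈ paramBall d B := hball (by simpa [dist_eq_norm] using hdist)
    -- Moves the curvature from the unknown intermediate point `b'` to the fixed `b₀`, at a
    -- Lipschitz cost.
    have h1 : ∑ i ∈ Finset.range N, w i * (deriv ψ (inner ℝ b₀ (xs i)) * inner ℝ v (xs i) ^ 2) -
        (∑ i ∈ Finset.range N, w i * |m i|) * (2 * κ * ρ ^ 2) ≤
        ∑ i ∈ Finset.range N, w i * (deriv ψ (inner ℝ b' (xs i)) * inner ℝ v (xs i) ^ 2) := by
      rw [Finset.sum_mul, ← Finset.sum_sub_distrib]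
      refine Finset.sum_le_sum fun i hi => ?_
      have h2 := (abs_deriv_mul_sq_sub_le ψ b' b₀ (xs i) v).trans
        (mul_le_mul_of_nonneg_right (hlip i hi b' hmem) (sq_nonneg ‖v‖))
      rw [hv] at h2
      have h3 : m i * ‖b' - b₀‖ ≤ |m i| * (2 * κ) :=
        mul_le_mul (le_abs_self _) hdist (norm_nonneg _) (abs_nonneg _)
      have h4 := mul_le_mul_of_nonneg_right h3 (sq_nonneg ρ)
      have h5 := mul_le_mul_of_nonneg_left
        ((neg_le_of_abs_le h2).trans' (neg_le_neg h4)) (hw i hi)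
      linarith
    -- Writing `w i = 1 + (w i - 1)` separates the full-data curvature from its sampling error.
    have h2 : ∑ i ∈ Finset.range N, w i * (deriv ψ (inner ℝ b₀ (xs i)) * inner ℝ v (xs i) ^ 2) =
        ∑ i ∈ Finset.range N, deriv ψ (inner ℝ b₀ (xs i)) * inner ℝ v (xs i) ^ 2 +
        inner ℝ (outerVec v) (∑ i ∈ Finset.range N,
          (w i - 1) • (deriv ψ (inner ℝ b₀ (xs i)) • outerVec (xs i))) := by
      rw [inner_sum, ← Finset.sum_add_distrib]
      refine Finset.sum_congr rfl fun i _ => ?_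
      rw [inner_smul_right, inner_smul_right, inner_outerVec]
      ring
    have h3 := (abs_real_inner_le_norm (outerVec v) (∑ i ∈ Finset.range N,
          (w i - 1) • (deriv ψ (inner ℝ b₀ (xs i)) • outerVec (xs i))))
    rw [norm_outerVec, hv] at h3
    have h4 := neg_le_of_abs_le h3
    have h5 := hquad v
    rw [hv] at h5
    have hsc : totalScore ψ (Finset.range N) w xs ys b = ∑ i ∈ Finset.range N,
        (w i - 1) • ((ys i - ψ (inner ℝ b (xs i))) • xs i) := by
      have := totalScore_sub (ψ := ψ) (A := Finset.range N) (w := w) (z := xs) (y := ys) 1 b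
      rwa [← quasiScore_eq_totalScore, hzero, sub_zero] at this
    have h6 := real_inner_le_norm (totalScore ψ (Finset.range N) w xs ys b) v
    rw [hsc, hv] at h6
    rw [hsc]
    have hρ2 : 0 < ρ ^ 2 := by positivity
    -- Budget in units of `c * N * ρ ^ 2`: full curvature is at least 1, sampling error of the
    -- curvature costs at most 1/4, the Lipschitz error at most 1/4, and the score at `b`
    -- contributes less than 1/2.
    have h7 := mul_lt_mul_of_pos_right hscore hρ
    have h8 := mul_le_mul_of_nonneg_left hfrob.le hρ2.le
    have h9 := mul_le_mul_of_nonneg_right hm.le (by positivity : 0 ≤ 2 * κ * ρ ^ 2)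
    have h10 := mul_le_mul_of_nonneg_right hK (by positivity : 0 ≤ N * ρ ^ 2)
    nlinarith
  refine ⟨?_, fun β hβ => norm_sub_lt_of_totalScore_eq_zero hmono hw hρ hsphere hβ⟩
  obtain ⟨β, hβ, h0⟩ := exists_totalScore_eq_zero hψ.continuous hρ hsphere
  refine ⟨β, hball ?_, h0⟩
  rw [Metric.mem_closedBall, dist_eq_norm] at hβ ⊢
  have e : β - b₀ = (β - b) + (b - b₀) := by abel
  rw [e]
  exact (norm_add_le _ _).trans (by linarith)

end

/-! ### Laws of large numbers and moment bounds for the full data -/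

section


variable {Ω : Type*} [mΩ : MeasurableSpace Ω] {μ : Measure Ω}

lemma WithProbToOne.mono_ae {ι : Type*} {l : Filter ι} {E F : ι → Set Ω}
    (h : WithProbToOne μ l E) (hEF : ∀ᶠ k in l, ∀ᵐ ω ∂μ, ω ∈ E k → ω ∈ F k) :
    WithProbToOne μ l F := by
  refine tendsto_of_tendsto_of_tendsto_of_le_of_le' tendsto_const_nhds h
    (Eventually.of_forall fun _ => zero_le) ?_
  filter_upwards [hEF] with k hk
  refine measure_mono_ae ?_
  filter_upwards [hk] with ω hω hF hE
  exact hF (hω hE)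

lemma WithProbToOne.mono {ι : Type*} {l : Filter ι} {E F : ι → Set Ω}
    (h : WithProbToOne μ l E) (hEF : ∀ k, E k ⊆ F k) : WithProbToOne μ l F :=
  h.mono_ae (Eventually.of_forall fun k => Eventually.of_forall fun _ hω => hEF k hω)

lemma WithProbToOne.inter {ι : Type*} {l : Filter ι} {E F : ι → Set Ω}
    (hE : WithProbToOne μ l E) (hF : WithProbToOne μ l F) :
    WithProbToOne μ l fun k => E k ∩ F k := by
  have h := hE.add hF
  rw [add_zero] at h
  refine tendsto_of_tendsto_of_tendsto_of_le_of_le tendsto_const_nhds h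
    (fun _ => zero_le) fun k => ?_
  rw [Set.compl_inter]
  exact measure_union_le _ _

lemma WithProbToOne.comp {ι κ : Type*} {l : Filter ι} {l' : Filter κ} {E : ι → Set Ω}
    (h : WithProbToOne μ l E) {f : κ → ι} (hf : Tendsto f l' l) :
    WithProbToOne μ l' fun k => E (f k) :=
  Filter.Tendsto.comp (g := fun k => μ (E k)ᶜ) h hf

lemma withProbToOne_of_ae {ι : Type*} {l : Filter ι} {E : ι → Set Ω}
    (h : ∀ᶠ k in l, ∀ᵐ ω ∂μ, ω ∈ E k) : WithProbToOne μ l E := by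
  have h0 : WithProbToOne μ l fun _ => (Set.univ : Set Ω) := by
    simp only [WithProbToOne, Set.compl_univ, measure_empty]
    exact tendsto_const_nhds
  exact h0.mono_ae (h.mono fun k hk => hk.mono fun ω hω _ => hω)

lemma WithProbToOne.eventually_real_compl_le {ι : Type*} {l : Filter ι} {E : ι → Set Ω}
    (h : WithProbToOne μ l E) {η : ℝ} (hη : 0 < η) : ∀ᶠ k in l, μ.real (E k)ᶜ ≤ η := by
  filter_upwards [ENNReal.tendsto_nhds_zero.1 h _ (ENNReal.ofReal_pos.2 hη)] with k hk
  exact ENNReal.toReal_le_of_le_ofReal hη.le hk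

variable {d : ℕ} {ψ : ℝ → ℝ} {B : ℝ} {βt : Vec d} {x : ℕ → Ω → Vec d} {y : ℕ → Ω → ℝ}

lemma integrable_norm_pow_of_lintegral {E : Type*} [NormedAddCommGroup E] {f : Ω → E} {n : ℕ}
    (hf : AEStronglyMeasurable f μ) (h : ∫⁻ ω, ‖f ω‖ₑ ^ n ∂μ < ∞) :
    Integrable (fun ω => ‖f ω‖ ^ n) μ := by
  refine ⟨hf.norm.pow n, ?_⟩
  simpa only [HasFiniteIntegral, enorm_pow, enorm_norm] using h

lemma lintegral_lt_top_of_iSup {F : Vec d → Ω → ℝ≥0∞} {β : Vec d} (hβ : β ∈ paramBall d B)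
    (h : ∫⁻ ω, ⨆ β ∈ paramBall d B, F β ω ∂μ < ∞) : ∫⁻ ω, F β ω ∂μ < ∞ :=
  (lintegral_mono fun ω => le_iSup₂ (f := fun β (_ : β ∈ paramBall d B) => F β ω) β hβ).trans_lt h

lemma measurable_inner_fst (β : Vec d) : Measurable fun z : Vec d × ℝ => inner ℝ β z.1 :=
  measurable_const.inner measurable_fst

lemma Model.measurable_score (hmodel : Model μ ψ βt x y) (β : Vec d) :
    Measurable fun z : Vec d × ℝ => (z.2 - ψ (inner ℝ β z.1)) • z.1 :=
  (measurable_snd.sub (hmodel.smooth.continuous.measurable.comp (measurable_inner_fst β))).smul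
    measurable_fst

lemma MomentBounds.integrable_norm_pow (hmodel : Model μ ψ βt x y)
    (h : MomentBounds μ ψ B x y) : Integrable (fun ω => ‖x 0 ω‖ ^ 9) μ :=
  integrable_norm_pow_of_lintegral (hmodel.measurable_x 0).aestronglyMeasurable h.x_moment

lemma MomentBounds.integrable_response_pow (hmodel : Model μ ψ βt x y)
    (h : MomentBounds μ ψ B x y) : Integrable (fun ω => |y 0 ω| ^ 6) μ :=
  integrable_norm_pow_of_lintegral (hmodel.measurable_y 0).aestronglyMeasurable h.y_moment

lemma MomentBounds.integrable_mean_pow (hmodel : Model μ ψ βt x y)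
    (h : MomentBounds μ ψ B x y) (hβ : βt ∈ paramBall d B) :
    Integrable (fun ω => |ψ (inner ℝ βt (x 0 ω))| ^ 6) μ := by
  have hx := hmodel.measurable_x 0
  have hψ := hmodel.smooth.continuous.measurable
  exact integrable_norm_pow_of_lintegral
    (f := fun ω => ψ (inner ℝ βt (x 0 ω)))
    (hψ.comp (measurable_const.inner hx)).aestronglyMeasurable
    (lintegral_lt_top_of_iSup hβ h.mean_moment)

lemma MomentBounds.integrable_deriv_pow (hmodel : Model μ ψ βt x y)
    (h : MomentBounds μ ψ B x y) (hβ : βt ∈ paramBall d B) :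
    Integrable (fun ω => |deriv ψ (inner ℝ βt (x 0 ω))| ^ 6) μ := by
  have hx := hmodel.measurable_x 0
  exact integrable_norm_pow_of_lintegral
    (f := fun ω => deriv ψ (inner ℝ βt (x 0 ω)))
    ((measurable_deriv ψ).comp (measurable_const.inner hx)).aestronglyMeasurable
    (lintegral_lt_top_of_iSup hβ h.deriv_moment)

variable [IsProbabilityMeasure μ]

/-- The weak law of large numbers for functions of the observations. -/
lemma Model.withProbToOne_mean {E : Type*} [NormedAddCommGroup E] [NormedSpace ℝ E]
    [CompleteSpace E] [MeasurableSpace E] [BorelSpace E] (hmodel : Model μ ψ βt x y)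
    {g : Vec d × ℝ → E} (hg : Measurable g)
    (hint : Integrable (fun ω => g (x 0 ω, y 0 ω)) μ) {κ : ℝ} (hκ : 0 < κ) :
    WithProbToOne μ atTop fun N : ℕ => {ω |
      ‖(N : ℝ)⁻¹ • ∑ i ∈ Finset.range N, g (x i ω, y i ω) - ∫ ω, g (x 0 ω, y 0 ω) ∂μ‖ < κ} := by
  have hid : ∀ i, IdentDistrib (fun ω => g (x i ω, y i ω)) (fun ω => g (x 0 ω, y 0 ω)) μ μ :=
    fun i => (hmodel.ident i).comp hg
  have hindep : Pairwise (Function.onFun (· ⟂ᵢ[μ] ·) fun (i : ℕ) ω => g (x i ω, y i ω)) := fun i j hij =>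
    (hmodel.indep.indepFun hij).comp hg hg
  have hlln := strong_law_ae (fun i ω => g (x i ω, y i ω)) hint hindep hid
  have hm : ∀ i, AEStronglyMeasurable (fun ω => g (x i ω, y i ω)) μ := fun i =>
    ((hid i).integrable_iff.2 hint).aestronglyMeasurable
  have hmeas := tendstoInMeasure_of_tendsto_ae (μ := μ)
    (f := fun (N : ℕ) ω => (N : ℝ)⁻¹ • ∑ i ∈ Finset.range N, g (x i ω, y i ω))
    (g := fun _ => ∫ ω, g (x 0 ω, y 0 ω) ∂μ)
    (fun N => (Finset.aestronglyMeasurable_fun_sum _ fun i _ => hm i).const_smul _) hlln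
  have := tendstoInMeasure_iff_norm.1 hmeas κ hκ
  refine this.congr fun N => ?_
  congr 1
  ext ω
  simp

lemma Model.withProbToOne_mean_le (hmodel : Model μ ψ βt x y)
    {g : Vec d × ℝ → ℝ} (hg : Measurable g)
    (hint : Integrable (fun ω => g (x 0 ω, y 0 ω)) μ) :
    WithProbToOne μ atTop fun N : ℕ => {ω |
      ∑ i ∈ Finset.range N, g (x i ω, y i ω) ≤ N * (∫ ω, g (x 0 ω, y 0 ω) ∂μ + 1)} := by
  refine (hmodel.withProbToOne_mean hg hint one_pos).mono_ae ?_
  filter_upwards [eventually_gt_atTop 0] with N hN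
  refine Eventually.of_forall fun ω hω => ?_
  have hN' : (0 : ℝ) < N := by exact_mod_cast hN
  have hω' : |(N : ℝ)⁻¹ • ∑ i ∈ Finset.range N, g (x i ω, y i ω) - ∫ ω, g (x 0 ω, y 0 ω) ∂μ| < 1 := hω
  have h := (le_abs_self _).trans hω'.le
  rw [sub_le_iff_le_add, smul_eq_mul, inv_mul_le_iff₀ hN'] at h
  simpa only [Set.mem_ofPred, add_comm] using h

/-- A Young inequality with exponents 3/2 and 3, matched to the third moment of `m₁` and the sixth
of `‖x‖`. -/
lemma sq_mul_sq_le_cube_add {a b : ℝ} (ha : 0 ≤ a) :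
    a ^ 2 * b ^ 2 ≤ a ^ 3 + b ^ 6 := by
  rcases le_total a (b ^ 2) with h | h
  · have := pow_le_pow_left₀ ha h 2
    have h2 : a ^ 2 * b ^ 2 ≤ (b ^ 2) ^ 2 * b ^ 2 := by gcongr
    have : 0 ≤ a ^ 3 := by positivity
    nlinarith
  · have h2 : a ^ 2 * b ^ 2 ≤ a ^ 2 * a := by gcongr
    have : 0 ≤ b ^ 6 := by positivity
    nlinarith

lemma pow_le_one_add_pow {a : ℝ} (ha : 0 ≤ a) {m n : ℕ} (hmn : m ≤ n) : a ^ m ≤ 1 + a ^ n := by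
  rcases le_total a 1 with h | h
  · have := pow_le_one₀ (n := m) ha h
    have : 0 ≤ a ^ n := by positivity
    linarith
  · have := pow_le_pow_right₀ h hmn
    linarith

lemma sq_mul_sq_le {a b : ℝ} (ha : 0 ≤ a) (hb : 0 ≤ b) :
    a ^ 2 * b ^ 2 ≤ 2 + a ^ 6 + b ^ 9 := by
  have := sq_mul_sq_le_cube_add (b := b) ha
  have := pow_le_one_add_pow ha (show 3 ≤ 6 by norm_num)
  have := pow_le_one_add_pow hb (show 6 ≤ 9 by norm_num)
  linarith

lemma sq_mul_four_le {a b : ℝ} (ha : 0 ≤ a) (hb : 0 ≤ b) :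
    a ^ 2 * b ^ 4 ≤ 1 + a ^ 6 + b ^ 9 := by
  have h := pow_le_one_add_pow hb (show 6 ≤ 9 by norm_num)
  have ha6 : 0 ≤ a ^ 6 := by positivity
  have hb6 : 0 ≤ b ^ 6 := by positivity
  rcases le_total a b with hab | hab
  · have h2 : a ^ 2 * b ^ 4 ≤ b ^ 2 * b ^ 4 := by gcongr
    nlinarith
  · have h2 : a ^ 2 * b ^ 4 ≤ a ^ 2 * a ^ 4 := by gcongr
    nlinarith

/-- The integrand dominates the squared norm of a score term at any parameter within distance 1 of
`βt` in the parameter space, with `m` the Lipschitz constant of the mean. -/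
lemma MomentBounds.integrable_score_bound (hmodel : Model μ ψ βt x y)
    (h : MomentBounds μ ψ B x y) (hβ : βt ∈ paramBall d B) {m : Vec d → ℝ} (hm : Measurable m)
    (hint : Integrable (fun ω => m (x 0 ω) ^ 3) μ) :
    Integrable (fun ω => 3 * (|y 0 ω| ^ 2 + |ψ (inner ℝ βt (x 0 ω))| ^ 2 + |m (x 0 ω)| ^ 2) *
      ‖x 0 ω‖ ^ 2) μ := by
  have hx := hmodel.measurable_x 0
  have hy := hmodel.measurable_y 0
  have hψ : Measurable fun ω => ψ (inner ℝ βt (x 0 ω)) :=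
    hmodel.smooth.continuous.measurable.comp (measurable_const.inner hx)
  have hmx : Measurable fun ω => m (x 0 ω) := hm.comp hx
  have h9 := h.integrable_norm_pow hmodel
  have hdom := ((((h.integrable_response_pow hmodel).add (h.integrable_mean_pow hmodel hβ)).add
    hint.norm).add (h9.const_mul 3)).add (integrable_const (5 : ℝ))
  refine (hdom.const_mul 3).mono' ?_ (Eventually.of_forall fun ω => ?_)
  · have h1 : Measurable fun ω => |y 0 ω| := hy.norm
    have h2 : Measurable fun ω => |ψ (inner ℝ βt (x 0 ω))| := hψ.norm
    have h3 : Measurable fun ω => |m (x 0 ω)| := hmx.norm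
    exact ((((((h1.pow_const 2).add (h2.pow_const 2)).add (h3.pow_const 2)).const_mul 3)).mul
      (hx.norm.pow_const 2)).aestronglyMeasurable
  · have e1 := sq_mul_sq_le (abs_nonneg (y 0 ω)) (norm_nonneg (x 0 ω))
    have e2 := sq_mul_sq_le (abs_nonneg (ψ (inner ℝ βt (x 0 ω)))) (norm_nonneg (x 0 ω))
    have e3 := sq_mul_sq_le_cube_add (b := ‖x 0 ω‖) (abs_nonneg (m (x 0 ω)))
    have e4 := pow_le_one_add_pow (norm_nonneg (x 0 ω)) (show 6 ≤ 9 by norm_num)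
    rw [Real.norm_of_nonneg (by positivity)]
    simp only [Pi.add_apply, norm_pow, Real.norm_eq_abs]
    linarith

lemma MomentBounds.integrable_deriv_sq (hmodel : Model μ ψ βt x y)
    (h : MomentBounds μ ψ B x y) (hβ : βt ∈ paramBall d B) :
    Integrable (fun ω => |deriv ψ (inner ℝ βt (x 0 ω))| ^ 2 * ‖x 0 ω‖ ^ 4) μ := by
  have hx := hmodel.measurable_x 0
  have hψ : Measurable fun ω => |deriv ψ (inner ℝ βt (x 0 ω))| :=
    ((measurable_deriv ψ).comp (measurable_const.inner hx)).norm
  have hdom := ((h.integrable_deriv_pow hmodel hβ).add (h.integrable_norm_pow hmodel)).add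
    (integrable_const (1 : ℝ))
  refine hdom.mono' ((hψ.pow_const 2).mul (hx.norm.pow_const 4)).aestronglyMeasurable
    (Eventually.of_forall fun ω => ?_)
  have e1 := sq_mul_four_le (abs_nonneg (deriv ψ (inner ℝ βt (x 0 ω)))) (norm_nonneg (x 0 ω))
  rw [Real.norm_of_nonneg (by positivity)]
  simp only [Pi.add_apply]
  linarith

lemma MomentBounds.memLp_two_of_pow_six {f : Ω → ℝ} (hf : Measurable f)
    (h : Integrable (fun ω => |f ω| ^ 6) μ) : MemLp f 2 μ := by
  refine (memLp_two_iff_integrable_sq hf.aestronglyMeasurable).2 ?_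
  refine (h.add (integrable_const (1 : ℝ))).mono' (hf.pow_const 2).aestronglyMeasurable
    (Eventually.of_forall fun ω => ?_)
  have := pow_le_one_add_pow (abs_nonneg (f ω)) (show 2 ≤ 6 by norm_num)
  rw [norm_pow, Real.norm_eq_abs]
  simp only [Pi.add_apply]
  linarith

lemma MomentBounds.memLp_two_norm (hmodel : Model μ ψ βt x y)
    (h : MomentBounds μ ψ B x y) : MemLp (x 0) 2 μ := by
  have hx := hmodel.measurable_x 0
  refine (memLp_two_iff_integrable_sq_norm hx.aestronglyMeasurable).2 ?_
  refine ((h.integrable_norm_pow hmodel).add (integrable_const (1 : ℝ))).mono'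
    (hx.norm.pow_const 2).aestronglyMeasurable (Eventually.of_forall fun ω => ?_)
  have := pow_le_one_add_pow (norm_nonneg (x 0 ω)) (show 2 ≤ 9 by norm_num)
  rw [Real.norm_of_nonneg (by positivity)]
  simp only [Pi.add_apply]
  linarith

lemma MomentBounds.memLp_response (hmodel : Model μ ψ βt x y)
    (h : MomentBounds μ ψ B x y) : MemLp (y 0) 2 μ :=
  memLp_two_of_pow_six (hmodel.measurable_y 0) (h.integrable_response_pow hmodel)

lemma MomentBounds.memLp_mean (hmodel : Model μ ψ βt x y)
    (h : MomentBounds μ ψ B x y) (hβ : βt ∈ paramBall d B) :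
    MemLp (fun ω => ψ (inner ℝ βt (x 0 ω))) 2 μ :=
  memLp_two_of_pow_six
    (hmodel.smooth.continuous.measurable.comp (measurable_const.inner (hmodel.measurable_x 0)))
    (h.integrable_mean_pow hmodel hβ)

lemma MomentBounds.integrable_score (hmodel : Model μ ψ βt x y)
    (h : MomentBounds μ ψ B x y) (hβ : βt ∈ paramBall d B) :
    Integrable (fun ω => (y 0 ω - ψ (inner ℝ βt (x 0 ω))) • x 0 ω) μ := by
  have h1 : MemLp (fun ω => y 0 ω - ψ (inner ℝ βt (x 0 ω))) 2 μ :=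
    (h.memLp_response hmodel).sub (h.memLp_mean hmodel hβ)
  exact memLp_one_iff_integrable.1 ((h.memLp_two_norm hmodel).smul h1)

/-- The score at the true parameter has mean zero. -/
lemma MomentBounds.integral_score (hmodel : Model μ ψ βt x y)
    (h : MomentBounds μ ψ B x y) (hβ : βt ∈ paramBall d B) :
    ∫ ω, (y 0 ω - ψ (inner ℝ βt (x 0 ω))) • x 0 ω ∂μ = 0 := by
  -- Testing against a fixed `u` reduces to real-valued functions. Since `⟨u, x⟩` is a function of
  -- `x`, it can be pulled out of the conditional expectation of `y` given `x`.
  refine ext_inner_left ℝ fun u => ?_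
  rw [inner_zero_right, ← integral_inner (h.integrable_score hmodel hβ)]
  simp only [inner_smul_right]
  have hx := hmodel.measurable_x 0
  have hle : MeasurableSpace.comap (x 0) inferInstance ≤ mΩ := hx.comap_le
  have hu : MemLp (fun ω => inner ℝ u (x 0 ω)) 2 μ :=
    (h.memLp_two_norm hmodel).const_inner u
  have hum : StronglyMeasurable[MeasurableSpace.comap (x 0) inferInstance]
      fun ω => inner ℝ u (x 0 ω) :=
    (((innerSL ℝ u).continuous.measurable).comp (comap_measurable (x 0))).stronglyMeasurable
  have hyu : Integrable (fun ω => y 0 ω * inner ℝ u (x 0 ω)) μ :=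
    (h.memLp_response hmodel).integrable_mul hu
  have hψu : Integrable (fun ω => ψ (inner ℝ βt (x 0 ω)) * inner ℝ u (x 0 ω)) μ :=
    (h.memLp_mean hmodel hβ).integrable_mul hu
  simp only [sub_mul]
  rw [integral_sub hyu hψu, sub_eq_zero, ← integral_condExp hle]
  refine integral_congr_ae ?_
  have hy : Integrable (y 0) μ := (h.memLp_response hmodel).integrable one_le_two
  filter_upwards [condExp_mul_of_aestronglyMeasurable_right hum.aestronglyMeasurable hyu hy,
    hmodel.mean 0] with ω h1 h2
  refine h1.trans ?_
  rw [Pi.mul_apply, h2]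

end

/-! ### Consistency of the full-data estimator and the rate for the subsample estimator -/

section


lemma inv_le_mul_maxWeight {Ω : Type*} {N i : ℕ} (hi : i < N) (p : ℕ → Ω → ℝ) (ω : Ω) :
    (p i ω)⁻¹ ≤ N * maxWeight N p ω := by
  have hN : (0 : ℝ) < N := by exact_mod_cast Nat.zero_lt_of_lt hi
  have h := le_ciSup (f := fun i : Fin N => ((N : ℝ) * p i ω)⁻¹) (Set.finite_range _).bddAbove
    ⟨i, hi⟩
  rw [mul_inv, inv_mul_le_iff₀ hN] at h
  exact h

lemma sum_inv_mul_le {Ω : Type*} {N : ℕ} (p : ℕ → Ω → ℝ) (ω : Ω) {b : ℕ → ℝ} (hb : ∀ i, 0 ≤ b i)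
    {W S : ℝ} (hW : maxWeight N p ω ≤ W) (hW0 : 0 ≤ W) (hS : ∑ i ∈ Finset.range N, b i ≤ N * S) :
    ∑ i ∈ Finset.range N, (p i ω)⁻¹ * b i ≤ N ^ 2 * W * S := by
  calc ∑ i ∈ Finset.range N, (p i ω)⁻¹ * b i ≤ ∑ i ∈ Finset.range N, N * W * b i := by
        refine Finset.sum_le_sum fun i hi => mul_le_mul_of_nonneg_right ?_ (hb i)
        exact (inv_le_mul_maxWeight (Finset.mem_range.1 hi) p ω).trans (by gcongr)
    _ = N * W * ∑ i ∈ Finset.range N, b i := by rw [Finset.mul_sum]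
    _ ≤ N * W * (N * S) := by gcongr
    _ = N ^ 2 * W * S := by ring

lemma rpow_neg_half_sq {r : ℝ} (hr : 0 < r) : (r ^ (-(1 / 2) : ℝ)) ^ 2 = r⁻¹ := by
  rw [← Real.rpow_natCast, ← Real.rpow_mul hr.le]
  norm_num
  exact Real.rpow_neg_one r

lemma rpow_neg_half_mul_le {r D a : ℝ} (hr : 0 < r) (hD : 0 ≤ D) (ha : 0 < a)
    (h : (D / a) ^ 2 ≤ r) : r ^ (-(1 / 2) : ℝ) * D ≤ a := by
  refine (sq_le_sq₀ (by positivity) ha.le).1 ?_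
  rw [mul_pow, rpow_neg_half_sq hr, inv_mul_le_iff₀ hr]
  rw [div_pow, div_le_iff₀ (by positivity)] at h
  linarith

/-- Applied with `s` the mean at the random full-data estimator and `t` the mean at `βt`, so that
the residual is bounded by quantities free of the estimator. -/
lemma sq_norm_sub_le {y s t m : ℝ} (h : |s - t| ≤ |m|) :
    ‖y - s‖ ^ 2 ≤ 3 * (|y| ^ 2 + |t| ^ 2 + |m| ^ 2) := by
  have h1 : ‖y - s‖ ≤ |y| + |t| + |m| := by
    have e : y - s = y - t - (s - t) := by ring
    rw [e, Real.norm_eq_abs]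
    have h2 := abs_sub (y - t) (s - t)
    have h3 := abs_sub y t
    linarith
  refine (pow_le_pow_left₀ (norm_nonneg _) h1 2).trans ?_
  nlinarith [sq_nonneg (|y| - |t|), sq_nonneg (|y| - |m|), sq_nonneg (|t| - |m|)]

lemma measurable_score_comp {Ω : Type*} {m : MeasurableSpace Ω} {d : ℕ} {ψ : ℝ → ℝ}
    (hψ : Measurable ψ) {x : Ω → Vec d} {y : Ω → ℝ} (hxy : Measurable fun ω => (x ω, y ω))
    {b : Ω → Vec d} (hb : Measurable b) :
    Measurable fun ω => (y ω - ψ (inner ℝ (b ω) (x ω))) • x ω :=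
  (hxy.snd.sub (hψ.comp (hb.inner hxy.fst))).smul hxy.fst

lemma measurable_expectedSize {Ω : Type*} {m : MeasurableSpace Ω} {N : ℕ} {p : ℕ → Ω → ℝ}
    (hp : ∀ i < N, Measurable (p i)) : Measurable (expectedSize N p) :=
  Finset.measurable_fun_sum _ fun i hi => hp i (Finset.mem_range.1 hi)

lemma measurable_radius {Ω : Type*} {m : MeasurableSpace Ω} {N : ℕ} {p : ℕ → Ω → ℝ}
    (hp : ∀ i < N, Measurable (p i)) (D : ℝ) :
    Measurable fun ω => expectedSize N p ω ^ (-(1 / 2) : ℝ) * D :=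
  ((measurable_expectedSize hp).pow_const _).mul_const D

lemma measurable_outerVec {d : ℕ} : Measurable (outerVec (d := d)) := by
  refine Continuous.measurable ?_
  unfold outerVec
  fun_prop

variable {Ω : Type*} [mΩ : MeasurableSpace Ω] {d : ℕ} {ψ : ℝ → ℝ} {B : ℝ} {βt : Vec d}
  {x : ℕ → Ω → Vec d} {y : ℕ → Ω → ℝ} {μ : Measure Ω}

lemma IsPoissonSubsample.expectedSize_nonneg {N : ℕ} {p : ℕ → Ω → ℝ} {δ : ℕ → Ω → Bool}
    (h : IsPoissonSubsample μ x y N p δ) (ω : Ω) : 0 ≤ expectedSize N p ω :=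
  Finset.sum_nonneg fun i hi => (h.prob_mem i (Finset.mem_range.1 hi) ω).1.le

lemma condProbData_nonneg (N : ℕ) (A : Set Ω) : ∀ᵐ ω ∂μ, 0 ≤ condProbData μ x y N A ω :=
  condExp_nonneg (Eventually.of_forall fun ω =>
    Set.indicator_nonneg (fun _ _ => zero_le_one) ω)

variable [IsProbabilityMeasure μ]

lemma condProbData_le_add (N : ℕ) {A D₁ D₂ : Set Ω} (hA : MeasurableSet A)
    (h₁ : MeasurableSet D₁) (h₂ : MeasurableSet D₂) (h : A ⊆ D₁ ∪ D₂) :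
    ∀ᵐ ω ∂μ, condProbData μ x y N A ω ≤
      condProbData μ x y N D₁ ω + condProbData μ x y N D₂ ω := by
  have hi : ∀ {D : Set Ω}, MeasurableSet D → Integrable (D.indicator fun _ => (1 : ℝ)) μ :=
    fun hD => (integrable_const _).indicator hD
  have h1 : A.indicator (fun _ => (1 : ℝ)) ≤ᵐ[μ]
      D₁.indicator (fun _ => (1 : ℝ)) + D₂.indicator fun _ => (1 : ℝ) := by
    refine Eventually.of_forall fun ω => ?_
    have h0 : ∀ D : Set Ω, 0 ≤ D.indicator (fun _ => (1 : ℝ)) ω := fun D =>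
      Set.indicator_nonneg (fun _ _ => zero_le_one) ω
    by_cases hω : ω ∈ A
    · rw [Set.indicator_of_mem hω, Pi.add_apply]
      rcases h hω with hω' | hω'
      · rw [Set.indicator_of_mem hω']
        linarith [h0 D₂]
      · rw [Set.indicator_of_mem (s := D₂) hω']
        linarith [h0 D₁]
    · rw [Set.indicator_of_notMem hω]
      exact add_nonneg (h0 D₁) (h0 D₂)
  filter_upwards [condExp_mono (m := dataSigma x y N) (hi hA) ((hi h₁).add (hi h₂)) h1,
    condExp_add (hi h₁) (hi h₂) (dataSigma x y N)] with ω ha hb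
  exact ha.trans_eq hb

/-- Events of vanishing probability have vanishing conditional probability. -/
lemma WithProbToOne.condProbData_lt (hx : ∀ i, Measurable (x i)) (hy : ∀ i, Measurable (y i))
    {ι : Type*} {l : Filter ι} {E : ι → Set Ω} (hE : WithProbToOne μ l E) (N : ι → ℕ) {a : ℝ}
    (ha : 0 < a) : WithProbToOne μ l fun k =>
      {ω | condProbData μ x y (N k) (toMeasurable μ (E k)ᶜ) ω < a} := by
  have hbound : ∀ k, μ {ω | condProbData μ x y (N k) (toMeasurable μ (E k)ᶜ) ω < a}ᶜ ≤
      ENNReal.ofReal a⁻¹ * μ (E k)ᶜ := by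
    intro k
    -- `E k` need not be measurable, so its complement is replaced by a measurable hull of equal
    -- measure before Markov's inequality is applied to the conditional probability.
    set M := toMeasurable μ (E k)ᶜ with hM
    have hMm : MeasurableSet M := measurableSet_toMeasurable _ _
    have h1 := mul_meas_ge_le_integral_of_nonneg (μ := μ)
      (f := condProbData μ x y (N k) M) (condProbData_nonneg (N k) M) integrable_condExp a
    have h2 : ∫ ω, condProbData μ x y (N k) M ω ∂μ = μ.real M := by
      unfold condProbData
      rw [integral_condExp (dataSigma_le hx hy (N k)), integral_indicator hMm]
      simp
    have e : {ω | condProbData μ x y (N k) M ω < a}ᶜ = {ω | a ≤ condProbData μ x y (N k) M ω} := by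
      ext ω
      simp
    rw [h2] at h1
    rw [e, ← ENNReal.ofReal_toReal (measure_ne_top μ {ω | a ≤ condProbData μ x y (N k) M ω}),
      ← measure_toMeasurable (E k)ᶜ, ← hM, ← ENNReal.ofReal_toReal (measure_ne_top μ M),
      ← ENNReal.ofReal_mul (by positivity)]
    refine ENNReal.ofReal_le_ofReal ?_
    rw [inv_mul_eq_div, le_div_iff₀ ha, mul_comm]
    exact h1
  have h0 : Tendsto (fun k => ENNReal.ofReal a⁻¹ * μ (E k)ᶜ) l (𝓝 0) := by
    have := ENNReal.Tendsto.const_mul (a := ENNReal.ofReal a⁻¹) hE (Or.inr ENNReal.ofReal_ne_top)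
    rwa [mul_zero] at this
  exact tendsto_of_tendsto_of_tendsto_of_le_of_le tendsto_const_nhds h0 (fun _ => zero_le) hbound

/-- The full-data estimator is consistent. -/
lemma InnerPoints.consistent {βhat : ℕ → Ω → Vec d} (hmodel : Model μ ψ βt x y)
    (hinner : InnerPoints μ ψ B βt x y βhat) (hmoment : MomentBounds μ ψ B x y)
    (hposdef : UniformlyPosDef μ ψ B x) {κ : ℝ} (hκ : 0 < κ) :
    WithProbToOne μ atTop fun N => {ω | ‖βhat N ω - βt‖ < κ} := by
  obtain ⟨c, hc, hspec⟩ := hposdef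
  have hβt : βt ∈ paramBall d B := interior_subset hinner.truth_mem
  have hlln := hmodel.withProbToOne_mean (hmodel.measurable_score βt)
    (hmoment.integrable_score hmodel hβt) (mul_pos hc hκ)
  refine ((hinner.qle.inter hspec).inter hlln).mono_ae ?_
  filter_upwards [eventually_gt_atTop 0] with N hN
  refine Eventually.of_forall ?_
  rintro ω ⟨⟨⟨hmem, hzero⟩, hs⟩, hmean⟩
  have h := mul_norm_sub_le_of_quasiScore_eq_zero (hmodel.smooth.differentiable (by norm_num)) hN
    (fun β hβ u => mul_norm_sq_le_of_spectrum ψ (fun i => x i ω) N β (hs β hβ) u)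
    (interior_subset hmem) hβt hzero
  have hmean' : ‖(N : ℝ)⁻¹ • quasiScore ψ (fun i => x i ω) (fun i => y i ω) N βt -
      ∫ ω, (y 0 ω - ψ (inner ℝ βt (x 0 ω))) • x 0 ω ∂μ‖ < c * κ := hmean
  rw [hmoment.integral_score hmodel hβt, sub_zero] at hmean'
  exact lt_of_mul_lt_mul_left (h.trans_lt hmean') hc.le

set_option maxHeartbeats 1000000 in
/-- Where the inverse inclusion probabilities are of order `r⁻¹`, the subsample estimator is within
a multiple of `r ^ (-1/2)` of the full-data estimator. -/
theorem exists_rate {βhat : ℕ → Ω → Vec d} (hmodel : Model μ ψ βt x y)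
    (hinner : InnerPoints μ ψ B βt x y βhat) (hmoment : MomentBounds μ ψ B x y)
    (hposdef : UniformlyPosDef μ ψ B x) (hlip : LipschitzConditions μ ψ B x)
    {ι : Type*} {l : Filter ι} {N : ι → ℕ} {p : ι → ℕ → Ω → ℝ} {δ : ι → ℕ → Ω → Bool}
    (hN : Tendsto N l atTop) (hsub : ∀ k, IsPoissonSubsample μ x y (N k) (p k) (δ k))
    (hr : ∀ R : ℝ, WithProbToOne μ l (fun k => {ω | R < expectedSize (N k) (p k) ω}))
    {βtil : ι → Ω → Vec d}
    (hest : ∀ k, IsSubsampleEstimator μ ψ B x y (N k) (p k) (δ k) (βtil k))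
    (C : ℝ) {ε : ℝ} (hε : 0 < ε) :
    ∃ Δ : ℝ, 0 < Δ ∧ WithProbToOne μ l fun k => {ω |
      maxWeight (N k) (p k) ω ≤ C * (expectedSize (N k) (p k) ω)⁻¹ →
      condProbData μ x y (N k) {ω' | expectedSize (N k) (p k) ω' ^ (-(1 / 2) : ℝ) * Δ
        ≤ ‖βtil k ω' - βhat (N k) ω'‖} ω < ε} := by
  have hconsistent := fun κ (hκ : 0 < κ) => hinner.consistent hmodel hmoment hposdef hκ
  obtain ⟨c, hc, hspec⟩ := hposdef
  obtain ⟨m₁, m₂, hm₁, hm₂, hLip, hi₁, hi₂⟩ := hlip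
  have hβt : βt ∈ paramBall d B := interior_subset hinner.truth_mem
  have hψm : Measurable ψ := hmodel.smooth.continuous.measurable
  have hψd : Measurable (deriv ψ) := measurable_deriv ψ
  have hdat := dataSigma_le hmodel.measurable_x hmodel.measurable_y
  -- the averages over the full data which control the conditional moments
  set g₁ : Vec d × ℝ → ℝ := fun z =>
    3 * (|z.2| ^ 2 + |ψ (inner ℝ βt z.1)| ^ 2 + |m₁ z.1| ^ 2) * ‖z.1‖ ^ 2 with hg₁
  set g₂ : Vec d × ℝ → ℝ := fun z => |deriv ψ (inner ℝ βt z.1)| ^ 2 * ‖z.1‖ ^ 4 with hg₂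
  set g₃ : Vec d × ℝ → ℝ := fun z => |m₂ z.1| with hg₃
  have hsnd : Measurable fun z : Vec d × ℝ => |z.2| := measurable_snd.norm
  have hψβ : Measurable fun z : Vec d × ℝ => |ψ (inner ℝ βt z.1)| :=
    (hψm.comp (measurable_inner_fst βt)).norm
  have hψ'β : Measurable fun z : Vec d × ℝ => |deriv ψ (inner ℝ βt z.1)| :=
    (hψd.comp (measurable_inner_fst βt)).norm
  have hm₁' : Measurable fun z : Vec d × ℝ => |m₁ z.1| := (hm₁.comp measurable_fst).norm
  have hm₂' : Measurable fun z : Vec d × ℝ => |m₂ z.1| := (hm₂.comp measurable_fst).norm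
  have hfst : Measurable fun z : Vec d × ℝ => ‖z.1‖ := measurable_fst.norm
  have hL₁ := hmodel.withProbToOne_mean_le (g := g₁)
    (((((hsnd.pow_const 2).add (hψβ.pow_const 2)).add (hm₁'.pow_const 2)).const_mul 3).mul
      (hfst.pow_const 2)) (hmoment.integrable_score_bound hmodel hβt hm₁ (hi₁ 0))
  have hL₂ := hmodel.withProbToOne_mean_le (g := g₂) ((hψ'β.pow_const 2).mul (hfst.pow_const 4))
    (hmoment.integrable_deriv_sq hmodel hβt)
  have hL₃ := hmodel.withProbToOne_mean_le (g := g₃) hm₂' (hi₂ 0).norm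
  set S₁ := ∫ ω, g₁ (x 0 ω, y 0 ω) ∂μ + 1 with hS₁
  set S₂ := ∫ ω, g₂ (x 0 ω, y 0 ω) ∂μ + 1 with hS₂
  set S₃ := ∫ ω, g₃ (x 0 ω, y 0 ω) ∂μ + 1 with hS₃
  have hS₁0 : 0 < S₁ := add_pos_of_nonneg_of_pos
    (integral_nonneg fun ω => by simp only [hg₁, Pi.zero_apply]; positivity) one_pos
  have hS₂0 : 0 < S₂ := add_pos_of_nonneg_of_pos
    (integral_nonneg fun ω => by simp only [hg₂, Pi.zero_apply]; positivity) one_pos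
  have hS₃0 : 0 < S₃ := add_pos_of_nonneg_of_pos
    (integral_nonneg fun ω => by simp only [hg₃, Pi.zero_apply]; positivity) one_pos
  -- the constants
  set C' := |C| + 1 with hC'
  have hC'0 : 0 < C' := by positivity
  -- Markov's inequality at level `K * n` then fails with conditional probability at most `ε / 4`.
  set K := 4 * S₃ / ε with hK
  have hK0 : 0 < K := by positivity
  obtain ⟨κ₀, hκ₀, hball₀⟩ := Metric.nhds_basis_closedBall.mem_iff.1
    (mem_interior_iff_mem_nhds.1 hinner.truth_mem)
  -- The three bounds serve, in order, the domination of the score by `m₁`, the Lipschitz budget `2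
  -- * κ * K ≤ c / 4`, and keeping the ball of radius `2 * κ` in the parameter space.
  set κ := min 1 (min (c / (8 * K)) (κ₀ / 2)) with hκ
  have hκ0 : 0 < κ := by positivity
  have hκ1 : κ ≤ 1 := min_le_left _ _
  have hκK : 2 * κ * K ≤ c / 4 := by
    have h : κ ≤ c / (8 * K) := (min_le_right _ _).trans (min_le_left _ _)
    rw [le_div_iff₀ (by positivity)] at h
    linarith
  have hball : Metric.closedBall βt (2 * κ) ⊆ paramBall d B := by
    refine (Metric.closedBall_subset_closedBall ?_).trans hball₀
    have h : κ ≤ κ₀ / 2 := (min_le_right _ _).trans (min_le_right _ _)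
    linarith
  -- Chosen so that the Chebyshev bound for the score, `4 * C' * S₁ / (c ^ 2 * Δ ^ 2)`, equals `ε /
  -- 4`; the powers of `r` cancel.
  set Δ := Real.sqrt (16 * C' * S₁ / (c ^ 2 * ε)) with hΔ
  have hΔ0 : 0 < Δ := Real.sqrt_pos.2 (by positivity)
  have hΔ2 : Δ ^ 2 = 16 * C' * S₁ / (c ^ 2 * ε) := Real.sq_sqrt (by positivity)
  -- The first term gives `r ^ (-1/2) * Δ ≤ κ`; the second brings the Chebyshev bound for the
  -- curvature, `16 * C' * S₂ / (c ^ 2 * r)`, down to `ε / 4`.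
  set R := (Δ / κ) ^ 2 + 64 * C' * S₂ / (c ^ 2 * ε) with hR
  have hR0 : 0 ≤ R := by positivity
  -- the event on which the full data behave well
  set H : ι → Set Ω := fun k => ({ω | βhat (N k) ω ∈ interior (paramBall d B) ∧
      quasiScore ψ (fun i => x i ω) (fun i => y i ω) (N k) (βhat (N k) ω) = 0} ∩
    {ω | ∀ β ∈ paramBall d B, ∀ lam ∈ spectrum ℝ (infoMatrix ψ (fun i => x i ω) (N k) β),
      c ≤ lam} ∩ {ω | ‖βhat (N k) ω - βt‖ < κ} ∩
    {ω | ∑ i ∈ Finset.range (N k), g₁ (x i ω, y i ω) ≤ N k * S₁} ∩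
    {ω | ∑ i ∈ Finset.range (N k), g₂ (x i ω, y i ω) ≤ N k * S₂} ∩
    {ω | ∑ i ∈ Finset.range (N k), g₃ (x i ω, y i ω) ≤ N k * S₃}) ∩
    {ω | R < expectedSize (N k) (p k) ω} ∩
    {ω | (∀ i, ∀ β₁ ∈ paramBall d B, ∀ β₂ ∈ paramBall d B,
      |ψ (inner ℝ β₁ (x i ω)) - ψ (inner ℝ β₂ (x i ω))| ≤ m₁ (x i ω) * ‖β₁ - β₂‖ ∧
      spectralNorm (infoTerm ψ β₁ (x i ω) - infoTerm ψ β₂ (x i ω)) ≤ m₂ (x i ω) * ‖β₁ - β₂‖) ∧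
      ((∃ β ∈ paramBall d B, weightedScore ψ (fun i => x i ω) (fun i => y i ω) (N k)
        (fun i => p k i ω) (fun i => δ k i ω) β = 0) →
      weightedScore ψ (fun i => x i ω) (fun i => y i ω) (N k)
        (fun i => p k i ω) (fun i => δ k i ω) (βtil k ω) = 0)} with hH
  have hHprob : WithProbToOne μ l H :=
    (((((((hinner.qle.inter hspec).inter (hconsistent κ hκ0)).inter hL₁).inter hL₂).inter
      hL₃).comp hN).inter (hr R)).inter (withProbToOne_of_ae (Eventually.of_forall fun k =>
        (ae_all_iff.2 hLip).and (hest k).solves))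
  refine ⟨Δ, hΔ0, ?_⟩
  -- `H k` also involves the sample, through the clause on the estimator, so membership of the
  -- conditioning `ω` is not enough: the conditional probability of the complement must be small as
  -- well.
  refine (hHprob.inter (hHprob.condProbData_lt hmodel.measurable_x hmodel.measurable_y N
    (show 0 < ε / 4 by positivity))).mono_ae (Eventually.of_forall fun k => ?_)
  -- the three sampling events
  set n := N k with hn
  set q := p k with hq
  set δk := δ k with hδk
  have hs := hsub k
  rw [← hn, ← hq, ← hδk] at hs
  set ρ : Ω → ℝ := fun ω => expectedSize n q ω ^ (-(1 / 2) : ℝ) * Δ with hρ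
  set v₁ : ℕ → Ω → Vec d := fun i ω =>
    (y i ω - ψ (inner ℝ (βhat n ω) (x i ω))) • x i ω with hv₁
  set v₂ : ℕ → Ω → EuclideanSpace ℝ (Fin d × Fin d) := fun i ω =>
    deriv ψ (inner ℝ βt (x i ω)) • outerVec (x i ω) with hv₂
  set b : ℕ → Ω → ℝ := fun i ω => |m₂ (x i ω)| with hb
  have hxF : ∀ i < n, Measurable[dataSigma x y n] (x i) := fun i hi =>
    measurable_fst.comp (measurable_dataSigma_pair x y hi)
  have hv₁m : ∀ i < n, Measurable[dataSigma x y n] (v₁ i) := fun i hi =>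
    measurable_score_comp hψm (measurable_dataSigma_pair x y hi) (hinner.measurable_qle n)
  have hv₂m : ∀ i < n, Measurable[dataSigma x y n] (v₂ i) := fun i hi =>
    (show Measurable fun v : Vec d => deriv ψ (inner ℝ βt v) • outerVec v from
      (hψd.comp (measurable_const.inner measurable_id)).smul measurable_outerVec).comp (hxF i hi)
  have hbm : ∀ i < n, Measurable[dataSigma x y n] (b i) := fun i hi =>
    (show Measurable fun v : Vec d => |m₂ v| from hm₂.norm).comp (hxF i hi)
  have hρm : Measurable[dataSigma x y n] ρ := measurable_radius hs.measurable_prob Δ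
  have ht₁m : Measurable[dataSigma x y n] fun ω => c / 2 * ρ ω * n :=
    (show Measurable fun t : ℝ => c / 2 * t * n by fun_prop).comp hρm
  set A : Set Ω := {ω | ρ ω ≤ ‖βtil k ω - βhat n ω‖} with hA
  set M : Set Ω := toMeasurable μ (H k)ᶜ with hM
  set D₁ : Set Ω := {ω | (c / 2 * ρ ω * n) ^ 2 ≤ ‖∑ i ∈ Finset.range n,
    (inclWeight (fun i => q i ω) (inclSet n δk ω) i - 1) • v₁ i ω‖ ^ 2} with hD₁
  set D₂ : Set Ω := {ω | (c / 4 * n) ^ 2 ≤ ‖∑ i ∈ Finset.range n,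
    (inclWeight (fun i => q i ω) (inclSet n δk ω) i - 1) • v₂ i ω‖ ^ 2} with hD₂
  set D₃ : Set Ω := {ω | K * n ≤ ∑ i ∈ Finset.range n,
    inclWeight (fun i => q i ω) (inclSet n δk ω) i * b i ω} with hD₃
  have hpm : ∀ i < n, Measurable (q i) := fun i hi =>
    (hs.measurable_prob i hi).mono (hdat n) le_rfl
  have hAm : MeasurableSet A := measurableSet_le (hρm.mono (hdat n) le_rfl)
    ((hest k).measurable.sub ((hinner.measurable_qle n).mono (hdat n) le_rfl)).norm
  have hMm : MeasurableSet M := measurableSet_toMeasurable _ _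
  have hD₁m : MeasurableSet D₁ := measurableSet_mem_inclSet hs.measurable_incl
    (G := fun s => {ω | (c / 2 * ρ ω * n) ^ 2 ≤ ‖∑ i ∈ Finset.range n,
      (inclWeight (fun i => q i ω) s i - 1) • v₁ i ω‖ ^ 2}) fun s => measurableSet_le
      ((ht₁m.mono (hdat n) le_rfl).pow_const 2) (measurable_norm_sq_sum_inclWeight hpm
        (fun i hi => (hv₁m i hi).mono (hdat n) le_rfl) s 1)
  have hD₂m : MeasurableSet D₂ := measurableSet_mem_inclSet hs.measurable_incl
    (G := fun s => {ω | (c / 4 * n) ^ 2 ≤ ‖∑ i ∈ Finset.range n,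
      (inclWeight (fun i => q i ω) s i - 1) • v₂ i ω‖ ^ 2}) fun s => measurableSet_le
      measurable_const (measurable_norm_sq_sum_inclWeight hpm
        (fun i hi => (hv₂m i hi).mono (hdat n) le_rfl) s 1)
  have hD₃m : MeasurableSet D₃ := measurableSet_mem_inclSet hs.measurable_incl
    (G := fun s => {ω | K * n ≤ ∑ i ∈ Finset.range n,
      inclWeight (fun i => q i ω) s i * b i ω}) fun s => measurableSet_le measurable_const (by
        have := measurable_sum_inclWeight hpm
          (fun i hi => (hbm i hi).mono (hdat n) le_rfl) s 0
        simpa only [sub_zero, smul_eq_mul] using this)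
  have hprob : ∀ ω, ∀ i ∈ Finset.range n, 0 < q i ω ∧ q i ω ≤ 1 := fun ω i hi =>
    hs.prob_mem i (Finset.mem_range.1 hi) ω
  have hsize : ∀ ω ∈ H k, R < expectedSize n q ω ∧ 0 < n := by
    intro ω hω
    have h1 : R < expectedSize n q ω := hω.1.2
    refine ⟨h1, Nat.pos_of_ne_zero fun h0 => ?_⟩
    rw [expectedSize, h0, Finset.range_zero, Finset.sum_empty] at h1
    linarith
  -- Outside the four bad events the deterministic localization applies: a zero exists in the
  -- parameter space, so the estimator is a zero, and every zero is within `ρ`.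
  have hsubset : A ⊆ M ∪ (D₁ ∪ (D₂ ∪ D₃)) := by
    intro ω hωA
    by_contra hcon
    simp only [Set.mem_union, not_or] at hcon
    obtain ⟨hωM, hω₁, hω₂, hω₃⟩ := hcon
    have hωH : ω ∈ H k := by
      by_contra h
      exact hωM (subset_toMeasurable μ _ h)
    obtain ⟨hRr, hn0⟩ := hsize ω hωH
    have hn0' : (0 : ℝ) < n := by exact_mod_cast hn0
    obtain ⟨⟨⟨⟨⟨⟨⟨⟨_, hzero⟩, hspecω⟩, hdist⟩, _⟩, _⟩, _⟩, _⟩, hLipω, hsolves⟩ := hωH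
    have hr0 : 0 < expectedSize n q ω := hR0.trans_lt hRr
    have hρ0 : 0 < ρ ω := mul_pos (Real.rpow_pos_of_pos hr0 _) hΔ0
    have hρκ : ρ ω ≤ κ := rpow_neg_half_mul_le hr0 hΔ0.le hκ0
      (((le_add_iff_nonneg_right _).2 (by positivity)).trans hRr.le)
    have hquad : ∀ u : Vec d, c * ‖u‖ ^ 2 * n ≤
        ∑ i ∈ Finset.range n, deriv ψ (inner ℝ βt (x i ω)) * inner ℝ u (x i ω) ^ 2 := by
      intro u
      have h := mul_norm_sq_le_of_spectrum ψ (fun i => x i ω) n βt (hspecω βt hβt) u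
      rwa [inv_mul_eq_div, le_div_iff₀ hn0'] at h
    have hkey := exists_zero_and_norm_sub_lt (B := B) (xs := fun i => x i ω)
      (ys := fun i => y i ω) (w := inclWeight (fun i => q i ω) (inclSet n δk ω))
      (m := fun i => m₂ (x i ω)) hmodel.smooth hmodel.deriv_pos
      (fun i hi => inclWeight_nonneg (hprob ω) _ hi) hρ0 hρκ hdist hball hquad
      (lt_of_pow_lt_pow_left₀ 2 (by positivity) (not_le.1 hω₂))
      (fun i _ β hβ => (hLipω i β hβ βt hβt).2) (not_le.1 hω₃) hκK hzero
      (lt_of_pow_lt_pow_left₀ 2 (by positivity) (not_le.1 hω₁))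
    simp only [weightedScore_eq_totalScore] at hsolves
    exact absurd hωA (not_le.2 (hkey.2 _ (hsolves hkey.1)))
  filter_upwards [condProbData_le_add (x := x) (y := y) (μ := μ) n hAm hMm
      (hD₁m.union (hD₂m.union hD₃m)) hsubset,
    condProbData_le_add (x := x) (y := y) (μ := μ) n (hD₁m.union (hD₂m.union hD₃m)) hD₁m
      (hD₂m.union hD₃m) subset_rfl,
    condProbData_le_add (x := x) (y := y) (μ := μ) n (hD₂m.union hD₃m) hD₂m hD₃m subset_rfl,
    condProbData_chebyshev hmodel.measurable_x hmodel.measurable_y hs hv₁m ht₁m,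
    condProbData_chebyshev hmodel.measurable_x hmodel.measurable_y hs hv₂m
      (@measurable_const _ _ _ (dataSigma x y n) (c / 4 * (n : ℝ))),
    condProbData_markov_total hmodel.measurable_x hmodel.measurable_y hs (t := K * n) hbm
      fun i ω => abs_nonneg _] with ω e₁ e₂ e₃ f₁ f₂ f₃
  -- The weight bound is needed only here, at the conditioning `ω`, to bound conditional moments;
  -- hence it can stay a pointwise hypothesis, usable with one `C` or with a `C` depending on `η`.
  rintro ⟨hωH, hωM⟩ hweight
  obtain ⟨hRr, hn0⟩ := hsize ω hωH
  have hn0' : (0 : ℝ) < n := by exact_mod_cast hn0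
  obtain ⟨⟨⟨⟨⟨⟨⟨_, _⟩, hdist⟩, hb₁⟩, hb₂⟩, hb₃⟩, _⟩, hLipω, _⟩ := hωH
  have hr0 : 0 < expectedSize n q ω := hR0.trans_lt hRr
  have hρ0 : 0 < ρ ω := mul_pos (Real.rpow_pos_of_pos hr0 _) hΔ0
  have hρ2 : ρ ω ^ 2 = Δ ^ 2 / expectedSize n q ω := by
    rw [hρ, mul_pow, rpow_neg_half_sq hr0, inv_mul_eq_div]
  have hW : maxWeight n q ω ≤ C' * (expectedSize n q ω)⁻¹ := hweight.trans
    (mul_le_mul_of_nonneg_right ((le_abs_self C).trans (by linarith)) (inv_nonneg.2 hr0.le))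
  have hW0 : 0 ≤ C' * (expectedSize n q ω)⁻¹ := by positivity
  have hv₁le : ∑ i ∈ Finset.range n, ‖v₁ i ω‖ ^ 2 ≤ n * S₁ := by
    refine (Finset.sum_le_sum fun i _ => ?_).trans hb₁
    simp only [hv₁, hg₁, norm_smul, mul_pow]
    refine mul_le_mul_of_nonneg_right ?_ (sq_nonneg _)
    have hbmem : βhat n ω ∈ paramBall d B := hball (by
      rw [Metric.mem_closedBall, dist_eq_norm]
      exact (le_of_lt hdist).trans (by linarith))
    have h1 := (hLipω i _ hbmem βt hβt).1
    have h2 : m₁ (x i ω) * ‖βhat n ω - βt‖ ≤ |m₁ (x i ω)| * 1 :=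
      mul_le_mul (le_abs_self _) ((le_of_lt hdist).trans hκ1) (norm_nonneg _) (abs_nonneg _)
    exact sq_norm_sub_le (h1.trans (h2.trans_eq (mul_one _)))
  have hv₂le : ∑ i ∈ Finset.range n, ‖v₂ i ω‖ ^ 2 ≤ n * S₂ := by
    refine (Finset.sum_le_sum fun i _ => le_of_eq ?_).trans hb₂
    simp only [hv₂, hg₂, norm_smul, norm_outerVec, Real.norm_eq_abs]
    ring
  have k₁ : condProbData μ x y n D₁ ω ≤ ε / 4 := by
    refine (f₁ (by positivity)).trans ?_
    rw [div_le_iff₀ (by positivity)]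
    refine (sum_inv_mul_le q ω (fun i => sq_nonneg _) hW hW0 hv₁le).trans (le_of_eq ?_)
    rw [mul_pow, mul_pow, hρ2, hΔ2]
    field_simp
    norm_num
  have k₂ : condProbData μ x y n D₂ ω ≤ ε / 4 := by
    refine (f₂ (by positivity)).trans ?_
    rw [div_le_iff₀ (by positivity)]
    refine (sum_inv_mul_le q ω (fun i => sq_nonneg _) hW hW0 hv₂le).trans ?_
    have hle : 64 * C' * S₂ / (c ^ 2 * ε) ≤ expectedSize n q ω :=
      ((le_add_iff_nonneg_left _).2 (by positivity)).trans hRr.le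
    rw [div_le_iff₀ (by positivity)] at hle
    have : n ^ 2 * (C' * (expectedSize n q ω)⁻¹) * S₂ =
        n ^ 2 / 64 * (64 * C' * S₂) / expectedSize n q ω := by
      field_simp
    rw [this, div_le_iff₀ hr0]
    calc (n : ℝ) ^ 2 / 64 * (64 * C' * S₂)
        ≤ n ^ 2 / 64 * (expectedSize n q ω * (c ^ 2 * ε)) := by gcongr
      _ = ε / 4 * (c / 4 * n) ^ 2 * expectedSize n q ω := by ring
  have k₃ : condProbData μ x y n D₃ ω ≤ ε / 4 := by
    refine (f₃ (by positivity)).trans ?_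
    rw [div_le_iff₀ (by positivity)]
    refine (show ∑ i ∈ Finset.range n, b i ω ≤ n * S₃ from hb₃).trans (le_of_eq ?_)
    rw [hK]
    field_simp
  have k₀ : condProbData μ x y n M ω < ε / 4 := hωM
  change condProbData μ x y n A ω < ε
  linarith

end

end PoissonQLE

/-! ### The three claims -/

theorem theorem1 {Ω : Type*} [MeasurableSpace Ω] (μ : Measure Ω) [IsProbabilityMeasure μ]
    {d : ℕ} (ψ : ℝ → ℝ) (B : ℝ) (βt : Vec d)
    (x : ℕ → Ω → Vec d) (y : ℕ → Ω → ℝ) (βhat : ℕ → Ω → Vec d)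
    (hmodel : Model μ ψ βt x y)
    (hinner : InnerPoints μ ψ B βt x y βhat)
    (hmoment : MomentBounds μ ψ B x y)
    (hposdef : UniformlyPosDef μ ψ B x)
    (hlip : LipschitzConditions μ ψ B x)
    -- the asymptotic regime: `k` runs along `l`, with sample size `N k` and subsample `δ k`
    {ι : Type*} (l : Filter ι) (N : ι → ℕ) (p : ι → ℕ → Ω → ℝ) (δ : ι → ℕ → Ω → Bool)
    (hN : Tendsto N l atTop)
    (hsub : ∀ k, IsPoissonSubsample μ x y (N k) (p k) (δ k))
    (hr : ∀ R : ℝ, WithProbToOne μ l (fun k => {ω | R < expectedSize (N k) (p k) ω}))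
    (hweight : IsBigOP μ l (fun k => maxWeight (N k) (p k))
      (fun k ω => (expectedSize (N k) (p k) ω)⁻¹))
    (βtil : ι → Ω → Vec d)
    (hest : ∀ k, IsSubsampleEstimator μ ψ B x y (N k) (p k) (δ k) (βtil k)) :
    -- consistency in conditional probability given the data, in probability
    (∀ ρ : ℝ, 0 < ρ → TendstoInMeasure μ
      (fun k => condProbData μ x y (N k) {ω | ρ ≤ ‖βtil k ω - βhat (N k) ω‖})
      l (fun _ => 0)) ∧
    -- rate of convergence `r ^ (-1/2)`
    (∀ ε : ℝ, 0 < ε → ∀ η : ℝ, 0 < η → ∃ Δ : ℝ, 0 < Δ ∧ ∀ᶠ k in l,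
      μ.real {ω | condProbData μ x y (N k)
        {ω' | expectedSize (N k) (p k) ω' ^ (-(1 / 2) : ℝ) * Δ
          ≤ ‖βtil k ω' - βhat (N k) ω'‖} ω < ε}ᶜ ≤ η) ∧
    -- if the constant in the weight condition does not depend on the probability level, then
    -- neither does `Δ`
    ((∃ C : ℝ, WithProbToOne μ l (fun k => {ω | maxWeight (N k) (p k) ω
        ≤ C * (expectedSize (N k) (p k) ω)⁻¹})) →
      ∀ ε : ℝ, 0 < ε → ∃ Δ : ℝ, 0 < Δ ∧ WithProbToOne μ l (fun k =>
        {ω | condProbData μ x y (N k)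
          {ω' | expectedSize (N k) (p k) ω' ^ (-(1 / 2) : ℝ) * Δ
            ≤ ‖βtil k ω' - βhat (N k) ω'‖} ω < ε})) := by
  have hcore := fun C {ε : ℝ} (hε : 0 < ε) => exists_rate hmodel hinner hmoment hposdef hlip hN
    hsub hr hest C hε
  have hrate : ∀ ε : ℝ, 0 < ε → ∀ η : ℝ, 0 < η → ∃ Δ : ℝ, 0 < Δ ∧ ∀ᶠ k in l,
      μ.real {ω | condProbData μ x y (N k)
        {ω' | expectedSize (N k) (p k) ω' ^ (-(1 / 2) : ℝ) * Δ
          ≤ ‖βtil k ω' - βhat (N k) ω'‖} ω < ε}ᶜ ≤ η := by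
    intro ε hε η hη
    -- Half of `η` pays for failure of the weight bound, half for the exceptional event of the rate.
    -- `C`, and with it `Δ`, depends on `η` only through this choice.
    obtain ⟨C, hC⟩ := hweight (η / 2) (half_pos hη)
    obtain ⟨Δ, hΔ, h⟩ := hcore C hε
    refine ⟨Δ, hΔ, ?_⟩
    filter_upwards [hC, h.eventually_real_compl_le (half_pos hη)] with k h1 h2
    refine le_trans ?_ (show η / 2 + η / 2 ≤ η by linarith)
    refine le_trans ?_ (add_le_add h1 h2)
    refine le_trans ?_ (measureReal_union_le _ _)
    refine ENNReal.toReal_mono (measure_ne_top μ _) (measure_mono ?_)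
    intro ω hω
    by_contra hcon
    rw [Set.mem_union, not_or] at hcon
    obtain ⟨hc1, hc2⟩ := hcon
    refine hω (not_not.1 hc2 ?_)
    have h0 := inv_nonneg.2 ((hsub k).expectedSize_nonneg ω)
    have h3 : |maxWeight (N k) (p k) ω| ≤ C * |(expectedSize (N k) (p k) ω)⁻¹| := not_lt.1 hc1
    rw [abs_of_nonneg h0] at h3
    exact (le_abs_self _).trans h3
  refine ⟨fun ρ hρ => ?_, hrate, ?_⟩
  · rw [tendstoInMeasure_iff_norm]
    intro ε hε
    refine ENNReal.tendsto_nhds_zero.2 fun η hη => ?_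
    obtain ⟨η', hη'0, hη'⟩ := ENNReal.lt_iff_exists_real_btwn.1 hη
    have hη'pos : 0 < η' := by
      by_contra! hle
      rw [ENNReal.ofReal_of_nonpos hle] at hη'
      exact lt_irrefl _ hη'.1
    obtain ⟨Δ, hΔ, hb⟩ := hrate (ε / 2) (half_pos hε) (η' / 2) (half_pos hη'pos)
    -- Beyond this size the radius `r ^ (-1/2) * Δ` is at most `ρ`, so the rate implies consistency.
    -- As `r` is random, the event that it is smaller enters as a second bad event, with conditional
    -- probability below `ε / 2`.
    have hsmall := hr ((Δ / ρ) ^ 2)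
    have hcond := hsmall.condProbData_lt hmodel.measurable_x hmodel.measurable_y N (half_pos hε)
    filter_upwards [hb, hcond.eventually_real_compl_le (half_pos hη'pos)] with k h1 h2
    have hdat := dataSigma_le hmodel.measurable_x hmodel.measurable_y (N k)
    have hdiff : Measurable fun ω => ‖βtil k ω - βhat (N k) ω‖ :=
      ((hest k).measurable.sub ((hinner.measurable_qle (N k)).mono hdat le_rfl)).norm
    have hrad : Measurable fun ω => expectedSize (N k) (p k) ω ^ (-(1 / 2) : ℝ) * Δ :=
      (measurable_radius (hsub k).measurable_prob Δ).mono hdat le_rfl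
    have hle := condProbData_le_add (x := x) (y := y) (μ := μ) (N k)
      (A := {ω | ρ ≤ ‖βtil k ω - βhat (N k) ω‖}) (measurableSet_le measurable_const hdiff)
      (measurableSet_le hrad hdiff)
      (measurableSet_toMeasurable μ {ω | (Δ / ρ) ^ 2 < expectedSize (N k) (p k) ω}ᶜ) (by
        intro ω hω
        by_cases hlarge : (Δ / ρ) ^ 2 < expectedSize (N k) (p k) ω
        · exact Or.inl ((rpow_neg_half_mul_le ((sq_nonneg _).trans_lt hlarge) hΔ.le hρ
            hlarge.le).trans hω)
        · exact Or.inr (subset_toMeasurable μ _ hlarge))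
    refine le_trans ?_ hη'.2.le
    rw [← ENNReal.ofReal_toReal (measure_ne_top μ _)]
    refine ENNReal.ofReal_le_ofReal ?_
    refine le_trans ?_ (show η' / 2 + η' / 2 ≤ η' by linarith)
    refine le_trans ?_ (add_le_add h1 h2)
    refine le_trans ?_ (measureReal_union_le _ _)
    refine ENNReal.toReal_mono (measure_ne_top μ _) (measure_mono_ae ?_)
    filter_upwards [hle, condProbData_nonneg (x := x) (y := y) (μ := μ) (N k)
      {ω | ρ ≤ ‖βtil k ω - βhat (N k) ω‖}] with ω h3 h4 h5
    have h5' : ε ≤ ‖condProbData μ x y (N k) {ω | ρ ≤ ‖βtil k ω - βhat (N k) ω‖} ω - 0‖ := h5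
    rw [sub_zero, Real.norm_of_nonneg h4] at h5'
    by_contra hcon
    have hcon' := not_or.1 hcon
    have h6 := not_not.1 hcon'.1
    have h7 := not_not.1 hcon'.2
    rw [Set.mem_ofPred] at h6 h7
    linarith
  · rintro ⟨C, hC⟩ ε hε
    obtain ⟨Δ, hΔ, h⟩ := hcore C hε
    exact ⟨Δ, hΔ, (h.inter hC).mono fun k ω hω => hω.1 hω.2⟩
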